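/- **Setting.** For $n\ge 1$ parties with local space $\mathbb C^d$, a product operator is $K=\bigotimes_{j=1}^n K^{(j)}$. The stabilizer $\mathcal S_\psi$ of a vector $|\psi\rangle$ is the set of invertible product operators $S$ with $S|\psi\rangle=|\psi\rangle$. The vector $|\psi\rangle\otimes|\phi\rangle$ is regarded as shared by the same $n$ parties, each holding one subsystem of each factor (local space $\mathbb C^d\otimes\mathbb C^d$); SWAP is the product operator by which every party exchanges its two subsystems. A two-outcome instrument (a success map $\Lambda$ and a failure map) is in SEP if both maps have finitely many product Kraus operators $X\mapsto\sum_i K_iXK_i^\dagger$, and $\sum K_i^\dagger K_i=\mathbb 1$, summed over both maps. It is in $\mathrm{LOCC}_{\mathbb N}$ if its Kraus operators are those of the branches of a finite protocol in which, step by step, one party makes a local measurement with finitely many outcomes that may depend on all earlier outcomes, the final branches being divided into success and failure. It is in LOCC if it is a limit of instruments obtained by such coarse-grainings from a sequence of finite protocols each of which continues the preceding one. A class of instruments transforms $|\psi\rangle$ into $|\phi\rangle$ with probability $p$ if some instrument of the class satisfies $\Lambda\big(|\psi\rangle\langle\psi|/\|\psi\|^2\big)=p\,|\phi\rangle\langle\phi|/\|\phi\|^2$;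 $p_{\max}(\psi\mapsto\phi)$ is the maximum of these $p$. **Theorem.** (a) Let $|\psi\rangle$ be a normalized state of $n$ qubits with $\mathcal S_{\psi^{\otimes 2}}=\{\mathbb 1,\mathrm{SWAP}\}$, let $\epsilon\in(0,1)$, and let $h_1,h_2$ be $2\times2$ matrices with $h_1^\dagger h_1=\mathrm{diag}(1,\epsilon)$ and $h_2^\dagger h_2=\mathrm{diag}(\epsilon,1)$. Put $|\psi_i\rangle=\mathbb 1\otimes\cdots\otimes\mathbb 1\otimes h_i|\psi\rangle$ (with $h_i$ acting on party $n$) and $n_i=\||\psi_i\rangle\|$. Then each of the maximal probabilities below exists for SEP, for LOCC and for $\mathrm{LOCC}_{\mathbb N}$, with the same value for all three classes: $$p_{\max}(\psi\mapsto\psi_i)=n_i^2\quad(i=1,2),\qquad p_{\max}(\psi^{\otimes2}\mapsto\psi_1\otimes\psi_2)=\frac{2}{1+\epsilon^2}\,p_{\max}(\psi\mapsto\psi_1)\,p_{\max}(\psi\mapsto\psi_2),$$ and the last is strictly greater than $p_{\max}(\psi\mapsto\psi_1)\,p_{\max}(\psi\mapsto\psi_2)$. It is attained by the following finite LOCC protocol.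 Party $n$ measures its two qubits with the operators $M_1=(1+\epsilon^2)^{-1/2}\,h_1\otimes h_2$, $M_2=(1+\epsilon^2)^{-1/2}\,h_2\otimes h_1$ and $M_3=\sqrt{\mathbb 1-M_1^\dagger M_1-M_2^\dagger M_2}$, where the operator under the root is positive semidefinite. On outcome 1 nothing more is done, on outcome 2 every party swaps its two qubits, and outcome 3 is failure. (b) The five-qubit state $$|\psi\rangle=\tfrac1{\sqrt{22}}\Big(\sqrt7\,|00000\rangle+\sqrt5\,|11111\rangle+\sum_{x\in\{0,1\}^5,\ |x|=3}|x\rangle\Big),$$ where $|x|$ is the number of ones, is normalized and satisfies $\mathcal S_{\psi^{\otimes2}}=\{\mathbb 1,\mathrm{SWAP}\}$. For all $\epsilon,h_1,h_2$ as in (a), $n_1=n_2=\sqrt{(1+\epsilon)/2}$, and for SEP, LOCC and $\mathrm{LOCC}_{\mathbb N}$ alike $$p_{\max}(\psi^{\otimes2}\mapsto\psi_1\otimes\psi_2)=\frac{2}{1+\epsilon^2}\Big(\frac{1+\epsilon}{2}\Big)^2>\frac{1+\epsilon}{2}=p_{\max}(\psi\mapsto\psi_1)=p_{\max}(\psi\mapsto\psi_2).$$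 -/

import Mathlib

open scoped Kronecker ComplexOrder Matrix

noncomputable section

namespace MultiState

/-! Multipartite pure states are given by their amplitudes in the computational basis:
`ι` is the set of parties and `d` indexes the basis of each local space `ℂ^d`. -/

/-- (Unnormalised) vectors of `⨂_{j ∈ ι} ℂ^d`. -/
abbrev Ket (ι d : Type) : Type := (ι → d) → ℂ

/-- Operators on `⨂_{j ∈ ι} ℂ^d`. -/
abbrev Op (ι d : Type) : Type := Matrix (ι → d) (ι → d) ℂ

/-- A tuple of local operators, one for each party. -/
abbrev LocalOps (ι d : Type) : Type := ι → Matrix d d ℂ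

section General

variable {ι d : Type} [Fintype ι] [DecidableEq ι] [Fintype d] [DecidableEq d]

/-- The Hilbert space norm of a vector. -/
def ketNorm (ψ : Ket ι d) : ℝ := ‖(WithLp.toLp 2 ψ : EuclideanSpace ℂ (ι → d))‖

/-- The density operator `|ψ⟩⟨ψ| / ‖ψ‖²` of the pure state represented by a nonzero vector. -/
def density (ψ : Ket ι d) : Op ι d :=
  (((ketNorm ψ) ^ 2 : ℝ) : ℂ)⁻¹ • Matrix.vecMulVec ψ (star ψ)

/-- The product operator `⨂_j K j`. -/
def prodOp (K : LocalOps ι d) : Op ι d := Matrix.of fun x y => ∏ j, K j (x j) (y j)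

/-- The stabilizer of a vector: the local invertible operators that leave it invariant. -/
def stabilizer (ψ : Ket ι d) : Set (Op ι d) :=
  {M | ∃ S : ι → GL d ℂ, M = prodOp (fun j => (S j : Matrix d d ℂ)) ∧ M *ᵥ ψ = ψ}

/-- `|ψ⟩ ⊗ |φ⟩` as a state shared by the same parties, each of which holds one local system of
each of the two states, i.e. has the local space `ℂ^d ⊗ ℂ^d`. -/
def ketTensor (ψ φ : Ket ι d) : Ket ι (d × d) :=
  fun x => ψ (fun j => (x j).1) * φ (fun j => (x j).2)

/-- The flip `u ⊗ v ↦ v ⊗ u` on one party's space `ℂ^d ⊗ ℂ^d`. -/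
def localSwap : Matrix (d × d) (d × d) ℂ := Matrix.of fun x y => if x = y.swap then 1 else 0

/-- The operator SWAP, i.e. the flip applied by every party. -/
def globalSwap : Op ι (d × d) := prodOp fun _ => localSwap

/-- The completely positive map `X ↦ ∑_K K X K†`, the sum over a finite family of
product Kraus operators (with multiplicities). -/
def krausMap (S : Multiset (LocalOps ι d)) (X : Op ι d) : Op ι d :=
  (S.map fun K => prodOp K * X * (prodOp K)ᴴ).sum

/-- The pair of a success map `Λs` and a failure map `Λf` is a two-outcome separable instrument:
`Λs` and `Λf` have finitely many product Kraus operators, and all of these together satisfy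
the completeness relation `∑_K K† K = 1`. -/
def IsSEP (Λs Λf : Op ι d → Op ι d) : Prop :=
  ∃ S F : Multiset (LocalOps ι d),
    ((S + F).map fun K => (prodOp K)ᴴ * prodOp K).sum = 1 ∧
    Λs = krausMap S ∧ Λf = krausMap F

/-- One step of an LOCC protocol. A stage of a protocol is the finite family of the accumulated
Kraus operators of its branches. In the branch `K`, a party `j` performs a local measurement with
measurement operators `A`; the outcome is communicated to all parties, so that the branch splits
into one branch for each outcome. Which party measures, and what it measures, may depend on the
branch, i.e. on all previous outcomes. -/
inductive LOCCStep : Multiset (LocalOps ι d) → Multiset (LocalOps ι d) → Prop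
  | measure (L : Multiset (LocalOps ι d)) (K : LocalOps ι d) (j : ι)
      (A : Multiset (Matrix d d ℂ)) (hA : (A.map fun a => aᴴ * a).sum = 1) :
      LOCCStep (K ::ₘ L) (A.map (fun a => Function.update K j (a * K j)) + L)

/-- `L` is the family of Kraus operators of the branches of an LOCC protocol with finitely many
rounds: it arises from the trivial protocol (nothing is done) in finitely many steps. -/
def IsProtocol (L : Multiset (LocalOps ι d)) : Prop :=
  Relation.ReflTransGen LOCCStep {fun _ => 1} L

/-- Two-outcome instruments implemented by LOCC with finitely many rounds: the branches of the
protocol are divided into successful and failing ones. -/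
def IsFiniteLOCC (Λs Λf : Op ι d → Op ι d) : Prop :=
  ∃ S F : Multiset (LocalOps ι d), IsProtocol (S + F) ∧ Λs = krausMap S ∧ Λf = krausMap F

/-- Two-outcome instruments implemented by LOCC, possibly with infinitely many rounds: there is a
sequence of finite protocols, each of which continues the preceding one, whose branches can be
divided into successful and failing ones at each stage so that the resulting instruments
converge to the given one. -/
def IsLOCC (Λs Λf : Op ι d → Op ι d) : Prop :=
  ∃ S F : ℕ → Multiset (LocalOps ι d),
    IsProtocol (S 0 + F 0) ∧
    (∀ k, Relation.ReflTransGen LOCCStep (S k + F k) (S (k + 1) + F (k + 1))) ∧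
    ∀ X, Filter.Tendsto (fun k => krausMap (S k) X) Filter.atTop (nhds (Λs X)) ∧
      Filter.Tendsto (fun k => krausMap (F k) X) Filter.atTop (nhds (Λf X))

/-- The probabilities `p` with which instruments of the class `C` transform the pure state `ψ`
into the pure state `φ`: the success map takes the initial state to `p` times the final one. -/
def successProbs (C : (Op ι d → Op ι d) → (Op ι d → Op ι d) → Prop) (ψ φ : Ket ι d) : Set ℝ :=
  {p | ∃ Λs Λf, C Λs Λf ∧ Λs (density ψ) = (p : ℂ) • density φ}

/-- `p` is the maximal probability of the transformation `ψ ↦ φ`, under SEP as well as under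
LOCC and under LOCC with finitely many rounds. -/
def IsMaxProb (ψ φ : Ket ι d) (p : ℝ) : Prop :=
  IsGreatest (successProbs IsSEP ψ φ) p ∧
  IsGreatest (successProbs IsLOCC ψ φ) p ∧
  IsGreatest (successProbs IsFiniteLOCC ψ φ) p

end General

section LastParty

variable {d : Type} [Fintype d] [DecidableEq d]

/-- The local operators `1 ⊗ ⋯ ⊗ 1 ⊗ h`: only the last party acts. -/
def onLast {n : ℕ} (h : Matrix d d ℂ) : LocalOps (Fin (n + 1)) d :=
  Function.update (fun _ => 1) (Fin.last n) h

/-- The vector `(1 ⊗ ⋯ ⊗ 1 ⊗ h)|ψ⟩`. -/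
def applyLast {n : ℕ} (h : Matrix d d ℂ) (ψ : Ket (Fin (n + 1)) d) : Ket (Fin (n + 1)) d :=
  prodOp (onLast h) *ᵥ ψ

end LastParty

/-- `H₁ = diag(1, ε)`. -/
def diagOne (ε : ℝ) : Matrix (Fin 2) (Fin 2) ℂ := !![1, 0; 0, (ε : ℂ)]

/-- `H₂ = diag(ε, 1)`. -/
def diagTwo (ε : ℝ) : Matrix (Fin 2) (Fin 2) ℂ := !![(ε : ℂ), 0; 0, 1]

/-- The operator `(1 + ε²)^{-1/2} (a ⊗ b)` of the last party on its two qubits. -/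
def measOp (ε : ℝ) (a b : Matrix (Fin 2) (Fin 2) ℂ) :
    Matrix (Fin 2 × Fin 2) (Fin 2 × Fin 2) ℂ :=
  ((√(1 / (1 + ε ^ 2)) : ℝ) : ℂ) • (a ⊗ₖ b)

/-- The successful branches of the protocol: on the first outcome nothing more is done, on the
second one every party applies the flip. -/
def protocolSuccess (n : ℕ) (ε : ℝ) (h₁ h₂ : Matrix (Fin 2) (Fin 2) ℂ) :
    Multiset (LocalOps (Fin (n + 1)) (Fin 2 × Fin 2)) :=
  {onLast (measOp ε h₁ h₂), fun j => localSwap * (onLast (measOp ε h₂ h₁) : LocalOps _ _) j}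

/-- The state of five qubits
`22^{-1/2} (√7 |00000⟩ + √5 |11111⟩ + the sum of all basis states with exactly three ones)`. -/
def fiveQubit : Ket (Fin 5) (Fin 2) := fun x =>
  ((√22 : ℝ) : ℂ)⁻¹ *
    (if ∑ j, (x j : ℕ) = 0 then ((√7 : ℝ) : ℂ)
      else if ∑ j, (x j : ℕ) = 5 then ((√5 : ℝ) : ℂ)
      else if ∑ j, (x j : ℕ) = 3 then 1 else 0)

end MultiState

end

set_option linter.unusedSectionVars false

/-! Upper bounds. Suppose a positive `W` and a constant `β` satisfy `β |c|² ≤ tr(K W K†)` for every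
product operator `K` with `K ψ = c φ`. In an exact instrument every success Kraus operator maps `ψ`
to some `c φ`, and the numbers `|c|²` add up to `p ‖ψ‖² / ‖φ‖²`. Completeness gives `∑ tr(K W K†) ≤
tr W`, hence `β p ‖ψ‖² ≤ ‖φ‖² tr W`. For infinite-round LOCC the Kraus operators at a finite stage
reach `φ` only approximately. A compactness argument on normalised product operators bounds the
violation of the inequality by the weight of the output off the line of `φ`, which vanishes in the
limit (`prob_le`).

The admissible `K` are known once the stabilizer is. If all symmetries of `ψ` are involutions, a
product operator taking `ψ` to `c H ψ` with `c ≠ 0` and `H` a product of invertible operators equals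
`c H M` with `M` a symmetry (`exists_mem_stabilizer_of_mulVec_eq_smul`). For one copy `M = 1`, and
`W` is the projector on a product basis state on which `h†h` equals 1. For two copies `M` is 1 or
SWAP, and `W` is the sum of the projectors on `|01⟩^{⊗n}` and `|10⟩^{⊗n}`. This `W` is SWAP
invariant, and `h₁†h₁ ⊗ h₂†h₂` has the values `1` and `ε²` there, so `β = 1 + ε²` and `tr W = 2`.
The stated protocols attain these bounds, and being finite they settle all three classes.

Stabilizer of the five-qubit example. Let `⨂ S_k` fix `ψ ⊗ ψ`. What `S_i ⊗ S_j` does to `ψ ⊗ ψ` can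
be undone by the other parties, so the result keeps the symmetry under exchanging `i` and `j` in
either copy alone. The two-party slices of `ψ` span the symmetric subspace, so `S_i ⊗ S_j` maps
products of symmetric tensors of the two copies to such products. This forces `S_j` to be
proportional to `S_i`, and contraction with a singlet in each copy shows that `S_i` preserves the
determinant of `2 × 2` matrices up to a factor. Hence `S_i` is proportional to `P ⊗ Q`, up to the
flip. Then `P^{⊗5}` and `Q^{⊗5}` preserve the line of `ψ`, i.e. the corresponding substitutions
preserve a binary quintic up to a factor. A quadratic covariant of that quintic leaves only scalars
(`scalar_of_quintic_invariant`). -/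

namespace MultiState

/-! ### Algebra of product operators and of the flip -/

section ProductOperators

variable {ι d : Type} [Fintype ι] [DecidableEq ι] [Fintype d] [DecidableEq d]

theorem prodOp_apply (K : LocalOps ι d) (x y : ι → d) : prodOp K x y = ∏ j, K j (x j) (y j) := rfl

theorem prodOp_mul (K L : LocalOps ι d) : prodOp K * prodOp L = prodOp fun j => K j * L j := by
  ext x y
  simp only [Matrix.mul_apply, prodOp_apply, ← Finset.prod_mul_distrib]
  exact (Fintype.prod_sum (fun j z => K j (x j) z * L j z (y j))).symm

theorem prodOp_one : prodOp (fun _ : ι => (1 : Matrix d d ℂ)) = 1 := by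
  ext x y
  simp only [prodOp_apply, Matrix.one_apply]
  by_cases h : x = y
  · simp [h]
  · obtain ⟨j, hj⟩ := Function.ne_iff.mp h
    rw [if_neg h]
    exact Finset.prod_eq_zero (Finset.mem_univ j) (if_neg hj)

theorem conjTranspose_prodOp (K : LocalOps ι d) : (prodOp K)ᴴ = prodOp fun j => (K j)ᴴ := by
  ext x y
  simp [Matrix.conjTranspose_apply, prodOp_apply]

theorem prodOp_update_apply (K : LocalOps ι d) (j : ι) (a : Matrix d d ℂ) (x y : ι → d) :
    prodOp (Function.update K j a) x y =
      a (x j) (y j) * ∏ k ∈ Finset.univ.erase j, K k (x k) (y k) := by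
  rw [prodOp_apply, ← Finset.mul_prod_erase _ _ (Finset.mem_univ j)]
  congr 1
  · simp
  · refine Finset.prod_congr rfl fun k hk => ?_
    rw [Function.update_of_ne (Finset.ne_of_mem_erase hk)]

/-- A product operator as a linear function of the operator of one of the parties. -/
def prodOpAt (K : LocalOps ι d) (j : ι) : Matrix d d ℂ →ₗ[ℂ] Op ι d where
  toFun a := prodOp (Function.update K j a)
  map_add' a b := by
    ext x y
    simp only [Matrix.add_apply, prodOp_update_apply, add_mul]
  map_smul' c a := by
    ext x y
    simp only [Matrix.smul_apply, prodOp_update_apply, smul_eq_mul, mul_assoc, RingHom.id_apply]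

theorem prodOpAt_apply (K : LocalOps ι d) (j : ι) (a : Matrix d d ℂ) :
    prodOpAt K j a = prodOp (Function.update K j a) := rfl

theorem prodOp_smul_at (K : LocalOps ι d) (j : ι) (c : ℂ) :
    prodOp (Function.update K j (c • K j)) = c • prodOp K := by
  rw [← prodOpAt_apply, map_smul, prodOpAt_apply, Function.update_eq_self]

theorem prodOp_smul (c : ι → ℂ) (K : LocalOps ι d) :
    prodOp (fun j => c j • K j) = (∏ j, c j) • prodOp K := by
  ext x y
  simp [prodOp_apply, Finset.prod_mul_distrib]

theorem prodOp_kronecker_mulVec (A B : LocalOps ι d) (ψ φ : Ket ι d) :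
    prodOp (fun j => A j ⊗ₖ B j) *ᵥ ketTensor ψ φ = ketTensor (prodOp A *ᵥ ψ) (prodOp B *ᵥ φ) := by
  ext x
  simp only [ketTensor, Matrix.mulVec, dotProduct, prodOp_apply, Matrix.kroneckerMap_apply]
  rw [Finset.sum_mul_sum, ← Fintype.sum_prod_type',
    ← (Equiv.arrowProdEquivProdArrow ι (fun _ => d) (fun _ => d)).sum_comp]
  refine Finset.sum_congr rfl fun y _ => ?_
  simp only [Equiv.arrowProdEquivProdArrow, Equiv.coe_fn_mk, Finset.prod_mul_distrib]
  ring

theorem localSwap_mul_self : (localSwap : Matrix (d × d) (d × d) ℂ) * localSwap = 1 := by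
  ext x y
  simp only [Matrix.mul_apply, localSwap, Matrix.of_apply, Matrix.one_apply, ite_mul, one_mul,
    zero_mul]
  rw [Finset.sum_eq_single x.swap]
  · simp [Prod.swap_inj]
  · rintro b - hb
    rw [if_neg]
    rintro rfl
    simp at hb
  · simp

theorem localSwap_conjTranspose : (localSwap : Matrix (d × d) (d × d) ℂ)ᴴ = localSwap := by
  ext x y
  simp only [Matrix.conjTranspose_apply, localSwap, Matrix.of_apply]
  by_cases h : x = y.swap
  · subst h; simp
  · rw [if_neg h, if_neg]
    · simp
    · rintro rfl
      simp at h

theorem globalSwap_mul_self : (globalSwap : Op ι (d × d)) * globalSwap = 1 := by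
  rw [globalSwap, prodOp_mul]
  simp only [localSwap_mul_self, prodOp_one]

theorem globalSwap_apply (x y : ι → d × d) :
    (globalSwap : Op ι (d × d)) x y = if (fun j => (y j).swap) = x then 1 else 0 := by
  rw [globalSwap, prodOp_apply]
  simp only [localSwap, Matrix.of_apply]
  by_cases h : (fun j => (y j).swap) = x
  · rw [if_pos h]
    subst h
    simp
  · rw [if_neg h]
    obtain ⟨j, hj⟩ := Function.ne_iff.mp h
    exact Finset.prod_eq_zero (Finset.mem_univ j) (if_neg (Ne.symm hj))

theorem globalSwap_mulVec_ketTensor (ψ φ : Ket ι d) :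
    globalSwap *ᵥ ketTensor ψ φ = ketTensor φ ψ := by
  ext x
  simp only [Matrix.mulVec, dotProduct, globalSwap_apply, ite_mul, one_mul, zero_mul]
  rw [Finset.sum_eq_single fun j => (x j).swap]
  · simp [ketTensor, mul_comm]
  · rintro b - hb
    rw [if_neg]
    rintro rfl
    simp at hb
  · simp

/-- The flip as an invertible operator. -/
def localSwapGL : GL (d × d) ℂ := ⟨localSwap, localSwap, localSwap_mul_self, localSwap_mul_self⟩

theorem one_mem_stabilizer (ψ : Ket ι d) : (1 : Op ι d) ∈ stabilizer ψ :=
  ⟨fun _ => 1, by simp [prodOp_one], by simp⟩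

theorem globalSwap_mem_stabilizer (ψ : Ket ι d) : globalSwap ∈ stabilizer (ketTensor ψ ψ) :=
  ⟨fun _ => localSwapGL, rfl, globalSwap_mulVec_ketTensor ψ ψ⟩

end ProductOperators

/-! ### Norms and density operators -/

section Norms

variable {ι d : Type} [Fintype ι] [DecidableEq ι] [Fintype d] [DecidableEq d]

theorem ketNorm_sq (ψ : Ket ι d) : ketNorm ψ ^ 2 = ∑ x, ‖ψ x‖ ^ 2 := by
  rw [ketNorm, EuclideanSpace.norm_sq_eq]

theorem star_dotProduct_self (ψ : Ket ι d) : star ψ ⬝ᵥ ψ = ((ketNorm ψ ^ 2 : ℝ) : ℂ) := by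
  rw [ketNorm_sq]
  push_cast
  refine Finset.sum_congr rfl fun x _ => ?_
  rw [Pi.star_apply, ← Complex.conj_mul']
  rfl

theorem ketNorm_nonneg (ψ : Ket ι d) : 0 ≤ ketNorm ψ := norm_nonneg _

theorem ketNorm_ne_zero {ψ : Ket ι d} : ketNorm ψ ≠ 0 ↔ ψ ≠ 0 := by
  rw [ketNorm, norm_ne_zero_iff, ne_eq, WithLp.toLp_eq_zero]

theorem ketNorm_ketTensor (ψ φ : Ket ι d) :
    ketNorm (ketTensor ψ φ) = ketNorm ψ * ketNorm φ := by
  refine (sq_eq_sq₀ (ketNorm_nonneg _)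
    (mul_nonneg (ketNorm_nonneg _) (ketNorm_nonneg _))).mp ?_
  rw [mul_pow, ketNorm_sq, ketNorm_sq, ketNorm_sq, Finset.sum_mul_sum, ← Fintype.sum_prod_type',
    ← (Equiv.arrowProdEquivProdArrow ι (fun _ => d) (fun _ => d)).sum_comp]
  refine Finset.sum_congr rfl fun y _ => ?_
  simp [ketTensor, Equiv.arrowProdEquivProdArrow, mul_pow]

theorem mul_density_mul_conjTranspose (K : Op ι d) (ψ : Ket ι d) :
    K * density ψ * Kᴴ =
      (((ketNorm ψ) ^ 2 : ℝ) : ℂ)⁻¹ • Matrix.vecMulVec (K *ᵥ ψ) (star (K *ᵥ ψ)) := by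
  rw [density, Matrix.mul_smul, Matrix.smul_mul, Matrix.mul_vecMulVec, Matrix.vecMulVec_mul,
    Matrix.star_mulVec]

theorem trace_density {ψ : Ket ι d} (h : ψ ≠ 0) : (density ψ).trace = 1 := by
  rw [density, Matrix.trace_smul, Matrix.trace_vecMulVec, dotProduct_comm, star_dotProduct_self,
    smul_eq_mul, inv_mul_cancel₀]
  have := ketNorm_ne_zero.mpr h
  exact_mod_cast pow_ne_zero 2 this

end Norms

/-! ### Kraus maps, completeness and the inclusions between the classes -/

section Instruments

variable {ι d : Type} [Fintype ι] [DecidableEq ι] [Fintype d] [DecidableEq d]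

theorem krausMap_add (S T : Multiset (LocalOps ι d)) (X : Op ι d) :
    krausMap (S + T) X = krausMap S X + krausMap T X := by
  simp [krausMap]

theorem krausMap_cons (K : LocalOps ι d) (S : Multiset (LocalOps ι d)) (X : Op ι d) :
    krausMap (K ::ₘ S) X = prodOp K * X * (prodOp K)ᴴ + krausMap S X := by
  simp [krausMap]

theorem krausMap_zero (X : Op ι d) : krausMap (0 : Multiset (LocalOps ι d)) X = 0 := by
  simp [krausMap]

theorem krausMap_posSemidef (S : Multiset (LocalOps ι d)) {W : Op ι d} (hW : W.PosSemidef) :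
    (krausMap S W).PosSemidef := by
  induction S using Multiset.induction_on with
  | empty => rw [krausMap_zero]; exact Matrix.PosSemidef.zero
  | cons K S ih => rw [krausMap_cons]; exact (hW.mul_mul_conjTranspose_same _).add ih

theorem trace_krausMap (S : Multiset (LocalOps ι d)) (X : Op ι d) :
    (krausMap S X).trace = ((S.map fun K => (prodOp K)ᴴ * prodOp K).sum * X).trace := by
  induction S using Multiset.induction_on with
  | empty => simp [krausMap]
  | cons K S ih =>
    rw [krausMap_cons, Matrix.trace_add, ih, Multiset.map_cons, Multiset.sum_cons, add_mul,
      Matrix.trace_add, Matrix.trace_mul_comm, ← mul_assoc]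

/-- The completeness relation for the Kraus operators of an instrument bounds the trace of the
output of its success map. -/
theorem trace_krausMap_le {S F : Multiset (LocalOps ι d)}
    (h : ((S + F).map fun K => (prodOp K)ᴴ * prodOp K).sum = 1) {W : Op ι d}
    (hW : W.PosSemidef) : (krausMap S W).trace.re ≤ W.trace.re := by
  have h1 : (krausMap (S + F) W).trace = W.trace := by rw [trace_krausMap, h, one_mul]
  rw [krausMap_add, Matrix.trace_add] at h1
  have h2 := (Complex.le_def.mp (krausMap_posSemidef F hW).trace_nonneg).1
  have h3 := congrArg Complex.re h1
  simp only [Complex.add_re, Complex.zero_re] at h2 h3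
  linarith

theorem conjTranspose_mul_self_prodOp (K : LocalOps ι d) :
    (prodOp K)ᴴ * prodOp K = prodOp fun j => (K j)ᴴ * K j := by
  rw [conjTranspose_prodOp, prodOp_mul]

/-- With the other factors fixed, `K†K` depends linearly on `a†a`, where `a` is the new measurement
operator of party `j`. Summing over outcomes therefore replaces `a†a` by 1. -/
theorem LOCCStep.sum_eq {L L' : Multiset (LocalOps ι d)} (h : LOCCStep L L') :
    (L'.map fun K => (prodOp K)ᴴ * prodOp K).sum = (L.map fun K => (prodOp K)ᴴ * prodOp K).sum := by
  obtain ⟨L, K, j, A, hA⟩ := h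
  rw [Multiset.map_add, Multiset.sum_add, Multiset.map_cons, Multiset.sum_cons, Multiset.map_map]
  congr 1
  have key : ∀ a : Matrix d d ℂ,
      ((fun K => (prodOp K)ᴴ * prodOp K) ∘ fun a => Function.update K j (a * K j)) a =
        (prodOpAt (fun k => (K k)ᴴ * K k) j ∘ₗ LinearMap.mulLeft ℂ (K j)ᴴ ∘ₗ
          LinearMap.mulRight ℂ (K j)) (aᴴ * a) := by
    intro a
    simp only [Function.comp_apply, LinearMap.comp_apply, LinearMap.mulLeft_apply,
      LinearMap.mulRight_apply, prodOpAt_apply, conjTranspose_mul_self_prodOp]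
    congr 1
    ext1 k
    by_cases hk : k = j
    · subst hk
      simp [Matrix.conjTranspose_mul, mul_assoc]
    · simp [hk]
  rw [Multiset.map_congr rfl fun a _ => key a, ← Function.comp_def (g := fun a => aᴴ * a),
    ← Multiset.map_map, ← map_multiset_sum, hA]
  simp only [LinearMap.comp_apply, LinearMap.mulLeft_apply, LinearMap.mulRight_apply,
    prodOpAt_apply, conjTranspose_mul_self_prodOp, one_mul]
  rw [Function.update_eq_self]

theorem sum_eq_of_reflTransGen {L L' : Multiset (LocalOps ι d)}
    (h : Relation.ReflTransGen LOCCStep L L') :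
    (L'.map fun K => (prodOp K)ᴴ * prodOp K).sum = (L.map fun K => (prodOp K)ᴴ * prodOp K).sum := by
  induction h with
  | refl => rfl
  | tail _ h ih => rw [h.sum_eq, ih]

theorem IsProtocol.sum_eq {L : Multiset (LocalOps ι d)} (h : IsProtocol L) :
    (L.map fun K => (prodOp K)ᴴ * prodOp K).sum = 1 := by
  rw [sum_eq_of_reflTransGen h]
  simp [prodOp_one]

theorem IsFiniteLOCC.isSEP {Λs Λf : Op ι d → Op ι d} (h : IsFiniteLOCC Λs Λf) : IsSEP Λs Λf := by
  obtain ⟨S, F, h, hs, hf⟩ := h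
  exact ⟨S, F, h.sum_eq, hs, hf⟩

theorem IsFiniteLOCC.isLOCC {Λs Λf : Op ι d → Op ι d} (h : IsFiniteLOCC Λs Λf) :
    IsLOCC Λs Λf := by
  obtain ⟨S, F, h, rfl, rfl⟩ := h
  exact ⟨fun _ => S, fun _ => F, h, fun _ => Relation.ReflTransGen.refl,
    fun X => ⟨tendsto_const_nhds, tendsto_const_nhds⟩⟩

end Instruments

end MultiState

/-! ### Upper bounds that survive the limit of infinitely many rounds -/

namespace MultiState

/-- On a compact set, a function which is nonpositive wherever `g ≥ 0` vanishes is dominated by a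
multiple of `g` up to an arbitrarily small constant. -/
theorem exists_le_mul_add_of_isCompact {X : Type*} [TopologicalSpace X] {U : Set X}
    (hU : IsCompact U) {f g : X → ℝ} (hf : Continuous f) (hg : Continuous g)
    (hg0 : ∀ x ∈ U, 0 ≤ g x) (hfg : ∀ x ∈ U, g x = 0 → f x ≤ 0) {δ : ℝ} (hδ : 0 < δ) :
    ∃ C, 0 ≤ C ∧ ∀ x ∈ U, f x ≤ C * g x + δ := by
  have hV : IsCompact (U ∩ {x | δ ≤ f x}) := hU.inter_right (isClosed_le continuous_const hf)
  rcases (U ∩ {x | δ ≤ f x}).eq_empty_or_nonempty with hE | hE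
  · refine ⟨0, le_rfl, fun x hx => ?_⟩
    by_contra! h
    have : x ∈ U ∩ {x | δ ≤ f x} := ⟨hx, by simpa using h.le⟩
    rw [hE] at this
    exact this
  · obtain ⟨y, hy, hy'⟩ := hV.exists_isMinOn hE hg.continuousOn
    obtain ⟨z, hz, hz'⟩ := hV.exists_isMaxOn hE hf.continuousOn
    have hgy : 0 < g y := by
      refine lt_of_le_of_ne (hg0 y hy.1) fun h => ?_
      have h1 := hfg y hy.1 h.symm
      have h2 : δ ≤ f y := hy.2
      linarith
    have hfz : 0 ≤ f z := hδ.le.trans hz.2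
    refine ⟨f z / g y, by positivity, fun x hx => ?_⟩
    by_cases h : δ ≤ f x
    · have h1 : g y ≤ g x := hy' ⟨hx, h⟩
      have h2 : f x ≤ f z := hz' ⟨hx, h⟩
      have h3 : f z / g y * g y ≤ f z / g y * g x := by gcongr
      rw [div_mul_cancel₀ _ hgy.ne'] at h3
      linarith
    · have := hg0 x hx
      have : 0 ≤ f z / g y * g x := by positivity
      linarith

section Limits

variable {ι d : Type} [Fintype ι] [DecidableEq ι] [Fintype d] [DecidableEq d]

theorem continuous_prodOp : Continuous (prodOp : LocalOps ι d → Op ι d) := by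
  refine continuous_matrix fun x y => ?_
  simp only [prodOp_apply]
  exact continuous_finsetProd _ fun j _ => (continuous_apply j).matrix_elem _ _

/-- Tuples of local operators all of whose matrix elements have modulus at most one. -/
def unitLocalOps (ι d : Type) : Set (LocalOps ι d) := {K | ∀ j a b, ‖K j a b‖ ≤ 1}

theorem isCompact_unitLocalOps : IsCompact (unitLocalOps ι d) := by
  let B : Set (ι → d → d → ℂ) := Set.univ.pi fun _ => Set.univ.pi fun _ => Set.univ.pi fun _ =>
    Metric.closedBall 0 1
  have hB : IsCompact B :=
    isCompact_univ_pi fun _ => isCompact_univ_pi fun _ => isCompact_univ_pi fun _ =>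
      isCompact_closedBall 0 1
  have h : unitLocalOps ι d = B := by
    refine Set.ext fun K => ?_
    exact ⟨fun h j _ a _ b _ => mem_closedBall_zero_iff.mpr (h j a b),
      fun h j a b => mem_closedBall_zero_iff.mp (h j trivial a trivial b trivial)⟩
  exact h ▸ hB

/-- Each factor is divided by its entry of largest modulus. The product `r` of these moduli is the
modulus of a single entry of `prodOp K`, so `r²` is at most the squared Hilbert–Schmidt norm.
Inequalities that scale by `r²` thus reduce to a compact set of operators. -/
theorem exists_prodOp_eq_smul (K : LocalOps ι d) :
    ∃ L ∈ unitLocalOps ι d, ∃ r : ℝ, prodOp K = (r : ℂ) • prodOp L ∧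
      r ^ 2 ≤ (prodOp K * (prodOp K)ᴴ).trace.re := by
  rcases isEmpty_or_nonempty d with hd | hd
  · rcases isEmpty_or_nonempty ι with hι | hι
    · refine ⟨K, fun j => hι.elim j, 1, by simp, ?_⟩
      have : K = fun _ => 1 := Subsingleton.elim _ _
      rw [this, prodOp_one]
      simp
    · refine ⟨K, fun j a => hd.elim a, 0, ?_, ?_⟩
      · ext x
        exact hd.elim (x hι.some)
      · simp [Matrix.trace]
  · have h : ∀ j, ∃ q : d × d, ∀ q' : d × d, ‖K j q'.1 q'.2‖ ≤ ‖K j q.1 q.2‖ :=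
      fun j => Finite.exists_max fun q : d × d => ‖K j q.1 q.2‖
    choose q hq using h
    refine ⟨fun j => ((‖K j (q j).1 (q j).2‖ : ℝ) : ℂ)⁻¹ • K j, fun j a b => ?_,
      ∏ j, ‖K j (q j).1 (q j).2‖, ?_, ?_⟩
    · change ‖(((‖K j (q j).1 (q j).2‖ : ℝ) : ℂ)⁻¹ • K j) a b‖ ≤ 1
      rw [Matrix.smul_apply, norm_smul, norm_inv, Complex.norm_real, norm_norm]
      exact inv_mul_le_one_of_le₀ (hq j (a, b)) (norm_nonneg _)
    · rw [Complex.ofReal_prod, ← prodOp_smul]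
      congr 1
      ext1 j
      rw [smul_smul]
      rcases eq_or_ne ‖K j (q j).1 (q j).2‖ 0 with h0 | h0
      · have : K j = 0 := by
          ext a b
          have := hq j (a, b)
          rw [h0] at this
          simpa using this
        rw [this, smul_zero]
      · rw [mul_inv_cancel₀ (by exact_mod_cast h0), one_smul]
    · have h1 : (prodOp K * (prodOp K)ᴴ).trace.re = ∑ x, ∑ y, ‖prodOp K x y‖ ^ 2 := by
        simp only [Matrix.trace, Matrix.diag, Matrix.mul_apply, Matrix.conjTranspose_apply,
          Complex.re_sum]
        refine Finset.sum_congr rfl fun x _ => Finset.sum_congr rfl fun y _ => ?_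
        rw [Complex.star_def, Complex.mul_conj']
        norm_cast
      rw [h1, ← norm_prod, ← prodOp_apply K (fun j => (q j).1) (fun j => (q j).2)]
      refine le_trans ?_ (Finset.single_le_sum (f := fun x => ∑ y, ‖prodOp K x y‖ ^ 2)
        (fun x _ => by positivity) (Finset.mem_univ fun j => (q j).1))
      exact Finset.single_le_sum (f := fun y => ‖prodOp K (fun j => (q j).1) y‖ ^ 2)
        (fun x _ => by positivity) (Finset.mem_univ fun j => (q j).2)

theorem norm_dotProduct_le (φ χ : Ket ι d) : ‖star φ ⬝ᵥ χ‖ ≤ ketNorm φ * ketNorm χ := by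
  have := norm_inner_le_norm (𝕜 := ℂ) (WithLp.toLp 2 φ : EuclideanSpace ℂ (ι → d)) (WithLp.toLp 2 χ)
  rwa [EuclideanSpace.inner_toLp_toLp, dotProduct_comm] at this

theorem exists_eq_smul_of_norm_dotProduct {φ χ : Ket ι d} (hφ : φ ≠ 0)
    (h : ‖star φ ⬝ᵥ χ‖ = ketNorm φ * ketNorm χ) : ∃ c : ℂ, χ = c • φ := by
  by_cases hχ : χ = 0
  · exact ⟨0, by simp [hχ]⟩
  have := norm_inner_eq_norm_iff (𝕜 := ℂ) (x := (WithLp.toLp 2 φ : EuclideanSpace ℂ (ι → d)))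
    (y := WithLp.toLp 2 χ) (by simpa using hφ) (by simpa using hχ)
  rw [EuclideanSpace.inner_toLp_toLp, dotProduct_comm] at this
  obtain ⟨r, -, hr⟩ := this.mp h
  exact ⟨r, congrArg (WithLp.ofLp) hr⟩

theorem ketNorm_smul (c : ℂ) (φ : Ket ι d) : ketNorm (c • φ) = ‖c‖ * ketNorm φ := by
  rw [ketNorm, WithLp.toLp_smul, norm_smul, ketNorm]

/-- The part of a positive operator that is not supported on the line of `φ`. -/
noncomputable def leak (φ : Ket ι d) (X : Op ι d) : ℝ :=
  ketNorm φ ^ 2 * X.trace.re - (star φ ⬝ᵥ X *ᵥ φ).re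

theorem continuous_leak (φ : Ket ι d) : Continuous (leak φ) := by
  unfold leak
  fun_prop

theorem leak_add (φ : Ket ι d) (X Y : Op ι d) : leak φ (X + Y) = leak φ X + leak φ Y := by
  simp only [leak, Matrix.trace_add, Matrix.add_mulVec, dotProduct_add, Complex.add_re]
  ring

theorem leak_zero (φ : Ket ι d) : leak φ 0 = 0 := by simp [leak]

theorem leak_real_smul (φ : Ket ι d) (r : ℝ) (X : Op ι d) :
    leak φ ((r : ℂ) • X) = r * leak φ X := by
  simp only [leak, Matrix.trace_smul, Matrix.smul_mulVec, dotProduct_smul, smul_eq_mul,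
    Complex.re_ofReal_mul]
  ring

/-- On a pure state the leak is the defect in the Cauchy–Schwarz inequality. For `φ ≠ 0` it vanishes
only if `χ` is a multiple of `φ`. -/
theorem leak_vecMulVec (φ χ : Ket ι d) :
    leak φ (Matrix.vecMulVec χ (star χ)) =
      (ketNorm φ * ketNorm χ) ^ 2 - ‖star φ ⬝ᵥ χ‖ ^ 2 := by
  have h1 : (Matrix.vecMulVec χ (star χ)).trace.re = ketNorm χ ^ 2 := by
    rw [Matrix.trace_vecMulVec, dotProduct_comm, star_dotProduct_self, Complex.ofReal_re]
  have h2 : star φ ⬝ᵥ Matrix.vecMulVec χ (star χ) *ᵥ φ = ((‖star φ ⬝ᵥ χ‖ ^ 2 : ℝ) : ℂ) := by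
    rw [Matrix.vecMulVec_mulVec, dotProduct_smul]
    have : star χ ⬝ᵥ φ = star (star φ ⬝ᵥ χ) := by
      rw [Matrix.star_dotProduct, dotProduct_comm]
    rw [this]
    push_cast
    rw [← Complex.mul_conj']
    simp
  rw [leak, h1, h2, Complex.ofReal_re, mul_pow]

theorem leak_density (φ : Ket ι d) : leak φ (density φ) = 0 := by
  rw [density, ← Complex.ofReal_inv, leak_real_smul, leak_vecMulVec, star_dotProduct_self,
    Complex.norm_real, Real.norm_of_nonneg (by positivity)]
  ring

/-- Duality bound, with `W` and `β` as a certificate. The hypothesis concerns only operators that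
reach the line of `φ` exactly, while the Kraus operators of the approximating stages need not. The
certificate is relaxed by a multiple of the leak plus a small multiple of `tr(K K†)`. Both
corrections can be summed over branches: the leak tends to zero, and the other is bounded by `δ tr
1`. -/
theorem prob_le {ψ φ : Ket ι d} (hψ : ψ ≠ 0) (hφ : φ ≠ 0) {W : Op ι d} (hW : W.PosSemidef)
    {β : ℝ} (hK : ∀ (K : LocalOps ι d) (c : ℂ), prodOp K *ᵥ ψ = c • φ →
      β * ‖c‖ ^ 2 ≤ (prodOp K * W * (prodOp K)ᴴ).trace.re)
    {S : ℕ → Multiset (LocalOps ι d)}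
    (hS : ∀ k, ∀ X : Op ι d, X.PosSemidef → (krausMap (S k) X).trace.re ≤ X.trace.re)
    {Λ : Op ι d → Op ι d}
    (hΛ : ∀ X, Filter.Tendsto (fun k => krausMap (S k) X) Filter.atTop (nhds (Λ X)))
    {p : ℝ} (hp : Λ (density ψ) = (p : ℂ) • density φ) :
    β * (p * ketNorm ψ ^ 2) ≤ W.trace.re * ketNorm φ ^ 2 := by
  have hψ0 := ketNorm_ne_zero.mpr hψ
  have hφ0 := ketNorm_ne_zero.mpr hφ
  have hψp : 0 < ketNorm ψ ^ 2 := by have := ketNorm_nonneg ψ; positivity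
  have hφp : 0 < ketNorm φ ^ 2 := by have := ketNorm_nonneg φ; positivity
  -- Chosen so that `γ tr(K ρ K†) = β |c|²` when `K ψ = c φ` and `ρ` is the density operator of `ψ`.
  set γ : ℝ := β * ketNorm ψ ^ 2 / ketNorm φ ^ 2 with hγ
  let g : Op ι d → ℝ := fun M => leak φ (M * density ψ * Mᴴ)
  let f : Op ι d → ℝ := fun M =>
    γ * (M * density ψ * Mᴴ).trace.re - (M * W * Mᴴ).trace.re
  have hgc : Continuous g := (continuous_leak φ).comp (by fun_prop)
  have hfc : Continuous f := by fun_prop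
  have hg : ∀ M, g M = (ketNorm ψ ^ 2)⁻¹ *
      ((ketNorm φ * ketNorm (M *ᵥ ψ)) ^ 2 - ‖star φ ⬝ᵥ M *ᵥ ψ‖ ^ 2) := fun M => by
    simp only [g]
    rw [mul_density_mul_conjTranspose, ← Complex.ofReal_inv, leak_real_smul, leak_vecMulVec]
  have hg0 : ∀ M, 0 ≤ g M := fun M => by
    rw [hg]
    refine mul_nonneg (by positivity) (sub_nonneg.mpr ?_)
    exact pow_le_pow_left₀ (norm_nonneg _) (norm_dotProduct_le _ _) 2
  have hfg : ∀ K : LocalOps ι d, g (prodOp K) = 0 → f (prodOp K) ≤ 0 := fun K h => by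
    rw [hg, mul_eq_zero, or_iff_right (by positivity), sub_eq_zero,
      sq_eq_sq₀ (mul_nonneg (ketNorm_nonneg _) (ketNorm_nonneg _)) (norm_nonneg _)] at h
    obtain ⟨c, hc⟩ := exists_eq_smul_of_norm_dotProduct hφ h.symm
    have h1 := hK K c hc
    have h2 : (prodOp K * density ψ * (prodOp K)ᴴ).trace.re =
        (ketNorm ψ ^ 2)⁻¹ * (‖c‖ ^ 2 * ketNorm φ ^ 2) := by
      rw [mul_density_mul_conjTranspose, ← Complex.ofReal_inv, Matrix.trace_smul,
        Matrix.trace_vecMulVec, dotProduct_comm, star_dotProduct_self, smul_eq_mul,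
        ← Complex.ofReal_mul, Complex.ofReal_re, hc, ketNorm_smul, mul_pow]
    simp only [f, h2, hγ]
    have h3 : β * ketNorm ψ ^ 2 / ketNorm φ ^ 2 *
      ((ketNorm ψ ^ 2)⁻¹ * (‖c‖ ^ 2 * ketNorm φ ^ 2)) = β * ‖c‖ ^ 2 := by
      field_simp
    linarith
  have key : ∀ δ : ℝ, 0 < δ → γ * p - (Λ W).trace.re ≤ δ * (1 : Op ι d).trace.re := by
    intro δ hδ
    obtain ⟨C, hC, hfC⟩ := exists_le_mul_add_of_isCompact (isCompact_unitLocalOps (ι := ι) (d := d))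
      (hfc.comp continuous_prodOp) (hgc.comp continuous_prodOp) (fun K _ => hg0 _)
      (fun K _ => hfg K) hδ
    -- Both `f` and `g` are homogeneous of degree two, so the estimate on the compact set extends to
    -- all product operators, with `δ` multiplied by `tr(K K†)`.
    have hfK : ∀ K : LocalOps ι d, f (prodOp K) ≤
        C * g (prodOp K) + δ * (prodOp K * (prodOp K)ᴴ).trace.re := by
      intro K
      obtain ⟨L, hL, r, hr, hr'⟩ := exists_prodOp_eq_smul K
      have hs : ∀ X : Op ι d, prodOp K * X * (prodOp K)ᴴ =
          ((r ^ 2 : ℝ) : ℂ) • (prodOp L * X * (prodOp L)ᴴ) := fun X => by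
        rw [hr, Matrix.conjTranspose_smul, Matrix.smul_mul, Matrix.smul_mul, Matrix.mul_smul,
          smul_smul, Complex.star_def, Complex.conj_ofReal]
        push_cast
        rw [sq]
      have h1 : f (prodOp K) = r ^ 2 * f (prodOp L) := by
        simp only [f]
        rw [hs, hs, Matrix.trace_smul, Matrix.trace_smul, smul_eq_mul, smul_eq_mul,
          Complex.re_ofReal_mul, Complex.re_ofReal_mul]
        ring
      have h2 : g (prodOp K) = r ^ 2 * g (prodOp L) := by
        simp only [g]
        rw [hs, leak_real_smul]
      have h3 : r ^ 2 * f (prodOp L) ≤ r ^ 2 * (C * g (prodOp L) + δ) := by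
        gcongr
        exact hfC L hL
      have h4 : δ * r ^ 2 ≤ δ * (prodOp K * (prodOp K)ᴴ).trace.re := by gcongr
      rw [h1, h2]
      linarith
    have hfS : ∀ T : Multiset (LocalOps ι d),
        γ * (krausMap T (density ψ)).trace.re - (krausMap T W).trace.re ≤
          C * leak φ (krausMap T (density ψ)) + δ * (krausMap T 1).trace.re := by
      intro T
      induction T using Multiset.induction_on with
      | empty => simp [krausMap_zero, leak_zero]
      | cons K T ih =>
        have := hfK K
        simp only [f, g] at this
        simp only [krausMap_cons, Matrix.trace_add, Complex.add_re, leak_add, mul_one]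
        linarith
    have htr : ∀ X, Filter.Tendsto (fun k => (krausMap (S k) X).trace.re) Filter.atTop
        (nhds (Λ X).trace.re) := fun X =>
      ((Complex.continuous_re.comp (continuous_id.matrix_trace)).tendsto _).comp (hΛ X)
    have h1 := ((htr (density ψ)).const_mul γ).sub (htr W)
    have h2 := ((((continuous_leak φ).tendsto _).comp (hΛ (density ψ))).const_mul C).add_const
      (δ * (1 : Op ι d).trace.re)
    have h3 := le_of_tendsto_of_tendsto' h1 h2 fun k => by
      have := hfS (S k)
      have h4 : δ * (krausMap (S k) 1).trace.re ≤ δ * (1 : Op ι d).trace.re := by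
        exact mul_le_mul_of_nonneg_left (hS k 1 Matrix.PosSemidef.one) hδ.le
      simp only [Function.comp_apply]
      linarith
    rw [hp, leak_real_smul, leak_density, Matrix.trace_smul, trace_density hφ] at h3
    simpa using h3
  have hW' : (Λ W).trace.re ≤ W.trace.re :=
    le_of_tendsto' (((Complex.continuous_re.comp (continuous_id.matrix_trace)).tendsto _).comp
      (hΛ W)) fun k => hS k W hW
  have h1 : (0 : ℝ) ≤ (1 : Op ι d).trace.re :=
    (Complex.le_def.mp (Matrix.PosSemidef.one (n := ι → d) (R := ℂ)).trace_nonneg).1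
  have h2 : γ * p ≤ (Λ W).trace.re := by
    refine le_of_forall_pos_le_add fun η hη => ?_
    have := key (η / ((1 : Op ι d).trace.re + 1)) (by positivity)
    have h3 : η / ((1 : Op ι d).trace.re + 1) * (1 : Op ι d).trace.re ≤ η := by
      rw [div_mul_eq_mul_div, div_le_iff₀ (by positivity)]
      nlinarith
    linarith
  have h3 : γ * p * ketNorm φ ^ 2 ≤ W.trace.re * ketNorm φ ^ 2 := by
    gcongr
    exact h2.trans hW'
  refine le_trans (le_of_eq ?_) h3
  rw [hγ]
  field_simp

/-- One finite protocol meeting the certificate suffices, since finite LOCC is contained in both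
LOCC and SEP. For SEP the bound `prob_le` is used with a constant sequence. -/
theorem isMaxProb_of {ψ φ : Ket ι d} (hψ : ψ ≠ 0) (hφ : φ ≠ 0) {W : Op ι d}
    (hW : W.PosSemidef) {β p : ℝ} (hβ : 0 < β)
    (hK : ∀ (K : LocalOps ι d) (c : ℂ), prodOp K *ᵥ ψ = c • φ →
      β * ‖c‖ ^ 2 ≤ (prodOp K * W * (prodOp K)ᴴ).trace.re)
    (hp : β * (p * ketNorm ψ ^ 2) = W.trace.re * ketNorm φ ^ 2)
    {S F : Multiset (LocalOps ι d)} (hSF : IsProtocol (S + F))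
    (hS : krausMap S (density ψ) = (p : ℂ) • density φ) : IsMaxProb ψ φ p := by
  have hψp : 0 < ketNorm ψ ^ 2 := by
    have := ketNorm_ne_zero.mpr hψ
    have := ketNorm_nonneg ψ
    positivity
  have hfin : IsFiniteLOCC (krausMap S) (krausMap F) := ⟨S, F, hSF, rfl, rfl⟩
  have bound : ∀ q : ℝ, β * (q * ketNorm ψ ^ 2) ≤ W.trace.re * ketNorm φ ^ 2 → q ≤ p := by
    intro q hq
    rw [← hp, mul_le_mul_iff_right₀ hβ, mul_le_mul_iff_left₀ hψp] at hq
    exact hq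
  have hsep : ∀ q ∈ successProbs IsSEP ψ φ, q ≤ p := by
    rintro q ⟨Λs, Λf, ⟨S, F, h1, rfl, rfl⟩, hq⟩
    exact bound q (prob_le hψ hφ hW hK (S := fun _ => S) (fun _ X hX => trace_krausMap_le h1 hX)
      (fun X => tendsto_const_nhds) hq)
  refine ⟨⟨⟨_, _, hfin.isSEP, hS⟩, hsep⟩, ⟨⟨_, _, hfin.isLOCC, hS⟩, ?_⟩,
    ⟨⟨_, _, hfin, hS⟩, ?_⟩⟩
  · rintro q ⟨Λs, Λf, ⟨S, F, h0, h1, h2⟩, hq⟩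
    have hprot : ∀ k, IsProtocol (S k + F k) := by
      intro k
      induction k with
      | zero => exact h0
      | succ k ih => exact ih.trans (h1 k)
    exact bound q (prob_le hψ hφ hW hK (fun k X hX => trace_krausMap_le (hprot k).sum_eq hX)
      (fun X => (h2 X).1) hq)
  · rintro q ⟨Λs, Λf, h, hq⟩
    exact hsep q ⟨Λs, Λf, h.isSEP, hq⟩

end Limits

/-! ### Product operators between states in the same orbit -/

section Stabilizers

variable {ι d : Type} [Fintype ι] [DecidableEq ι] [Fintype d] [DecidableEq d]

theorem prodOp_eq_zero {K : LocalOps ι d} {j : ι} (h : K j = 0) : prodOp K = 0 := by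
  ext x y
  exact Finset.prod_eq_zero (Finset.mem_univ j) (by rw [h]; rfl)

theorem prodOp_injective_at (j : ι) (a : Matrix d d ℂ)
    (h : prodOp (Function.update (fun _ : ι => (1 : Matrix d d ℂ)) j a) = 1) : a = 1 := by
  ext x y
  have := congrFun (congrFun h fun _ => x) (Function.update (fun _ => x) j y)
  rw [prodOp_update_apply, Finset.prod_eq_one] at this
  · simp only [Function.update_self, mul_one] at this
    rw [this, Matrix.one_apply, Matrix.one_apply]
    congr 1
    refine propext ⟨fun h => ?_, fun h => ?_⟩
    · simpa using congrFun h j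
    · subst h; simp
  · intro k hk
    rw [Function.update_of_ne (Finset.ne_of_mem_erase hk), Matrix.one_apply_eq]

/-- If every element of the stabilizer of `ψ` is an involution, then the product operators
mapping `ψ` to a nonzero multiple of `(⨂ H j) ψ` are locally invertible. -/
theorem det_ne_zero_of_mulVec_eq_smul {ψ : Ket ι d}
    (hstab : ∀ M ∈ stabilizer ψ, M * M = 1) (H : ι → GL d ℂ) {K : LocalOps ι d} {c : ℂ}
    (hc : c ≠ 0)
    (hK : prodOp K *ᵥ ψ = c • (prodOp (fun j => (H j : Matrix d d ℂ)) *ᵥ ψ)) (j : ι) :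
    (K j).det ≠ 0 := by
  intro hdet
  obtain ⟨v, hv, hvK⟩ := Matrix.exists_vecMul_eq_zero_iff.mpr hdet
  -- Since `v` annihilates the range of `K j`, contracting party `j` of `(⨂ H) ψ` with `v` gives
  -- zero. Equivalently, contracting party `j` of `ψ` itself with `w` gives zero.
  set w := v ᵥ* (H j : Matrix d d ℂ) with hw
  have hw0 : w ≠ 0 := fun h => hv <| by
    have : w ᵥ* ((H j)⁻¹ : GL d ℂ) = v := by
      rw [hw, Matrix.vecMul_vecMul, ← Units.val_mul, mul_inv_cancel, Units.val_one,
        Matrix.vecMul_one]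
    rw [← this, h, Matrix.zero_vecMul]
  obtain ⟨i, hi⟩ := Function.ne_iff.mp hw0
  set u : d → ℂ := Pi.single i (w i)⁻¹ with hu
  have huw : w ⬝ᵥ u = 1 := by
    rw [hu, dotProduct_single, mul_inv_cancel₀ hi]
  set P := Matrix.vecMulVec u w with hP
  have hPP : P * P = P := by
    rw [hP, Matrix.vecMulVec_mul_vecMulVec, huw, one_smul]
  have hkill : prodOp (Function.update (fun _ => 1) j P) *ᵥ ψ = 0 := by
    have h1 : prodOp (Function.update (fun k => (((H k)⁻¹ : GL d ℂ) : Matrix d d ℂ)) j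
        (Matrix.vecMulVec u v)) *ᵥ (c • (prodOp (fun j => (H j : Matrix d d ℂ)) *ᵥ ψ)) = 0 := by
      rw [← hK, Matrix.mulVec_mulVec, prodOp_mul, prodOp_eq_zero (j := j), Matrix.zero_mulVec]
      rw [Function.update_self, Matrix.vecMulVec_mul, hvK, Matrix.vecMulVec_zero]
    rw [Matrix.mulVec_smul, smul_eq_zero, or_iff_right hc, Matrix.mulVec_mulVec, prodOp_mul] at h1
    have h2 : Function.update (fun _ => 1) j P = fun k =>
        Function.update (fun k => (((H k)⁻¹ : GL d ℂ) : Matrix d d ℂ)) j (Matrix.vecMulVec u v) k *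
          (H k : Matrix d d ℂ) := by
      ext1 k
      by_cases hk : k = j
      · subst hk
        simp [hP, hw, Matrix.vecMulVec_mul]
      · simp [hk]
    rw [h2, h1]
  -- As `P` is idempotent and kills `ψ`, `1 + P` at party `j` is an invertible symmetry, with square
  -- `1 + 3P`. Being an involution would force `P = 0`, contradicting `tr P = 1`.
  let Q : GL d ℂ := ⟨1 + P, 1 - (2⁻¹ : ℂ) • P, by
      simp only [add_mul, mul_sub, one_mul, mul_one, Matrix.mul_smul, hPP]
      module, by
      simp only [mul_add, sub_mul, one_mul, mul_one, Matrix.smul_mul, hPP]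
      module⟩
  have hmem : prodOp (Function.update (fun _ => 1) j (1 + P)) ∈ stabilizer ψ := by
    refine ⟨Function.update (fun _ => 1) j Q, ?_, ?_⟩
    · congr 1
      ext1 k
      by_cases hk : k = j
      · subst hk; simp [Q]
      · simp [hk]
    · rw [← prodOpAt_apply, map_add, prodOpAt_apply, prodOpAt_apply, Matrix.add_mulVec, hkill,
        Function.update_eq_self (f := fun _ : ι => (1 : Matrix d d ℂ)), prodOp_one]
      simp
  have h2 := hstab _ hmem
  rw [prodOp_mul] at h2
  have h3 : (fun k => Function.update (fun _ : ι => (1 : Matrix d d ℂ)) j (1 + P) k *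
      Function.update (fun _ : ι => (1 : Matrix d d ℂ)) j (1 + P) k) =
      Function.update (fun _ => 1) j ((1 + P) * (1 + P)) := by
    ext1 k
    by_cases hk : k = j
    · subst hk; simp
    · simp [hk]
  rw [h3] at h2
  have h4 := prodOp_injective_at j _ h2
  have h5 : (3 : ℂ) • P = 0 := by
    have : (1 + P) * (1 + P) = 1 + (3 : ℂ) • P := by
      simp only [add_mul, mul_add, one_mul, mul_one, hPP]
      module
    rw [this] at h4
    simpa using h4
  have h6 : P = 0 := by simpa using h5
  have h7 := congrArg Matrix.trace h6
  rw [hP, Matrix.trace_vecMulVec, dotProduct_comm, huw] at h7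
  simp at h7

/-- Product operators mapping `ψ` to a nonzero multiple of `(⨂ H j) ψ` differ from `⨂ H j` by a
scalar and an element of the stabilizer. -/
theorem exists_mem_stabilizer_of_mulVec_eq_smul [Nonempty ι] {ψ : Ket ι d}
    (hstab : ∀ M ∈ stabilizer ψ, M * M = 1) (H : ι → GL d ℂ) {K : LocalOps ι d} {c : ℂ}
    (hc : c ≠ 0)
    (hK : prodOp K *ᵥ ψ = c • (prodOp (fun j => (H j : Matrix d d ℂ)) *ᵥ ψ)) :
    ∃ M ∈ stabilizer ψ, prodOp K = c • (prodOp (fun j => (H j : Matrix d d ℂ)) * M) := by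
  have hdet := det_ne_zero_of_mulVec_eq_smul hstab H hc hK
  let G : ι → GL d ℂ := fun j => Matrix.GeneralLinearGroup.mkOfDetNeZero (K j) (hdet j)
  let j₀ : ι := Classical.arbitrary ι
  let T : LocalOps ι d := fun j => ((H j)⁻¹ : GL d ℂ) * K j
  have hHT : prodOp (fun j => (H j : Matrix d d ℂ)) * prodOp T = prodOp K := by
    rw [prodOp_mul]
    congr 1
    ext1 j
    simp only [T]
    rw [← mul_assoc, ← Units.val_mul, mul_inv_cancel, Units.val_one, one_mul]
  have hTψ : prodOp T *ᵥ ψ = c • ψ := by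
    have : prodOp T = prodOp (fun j => (((H j)⁻¹ : GL d ℂ) : Matrix d d ℂ)) * prodOp K := by
      rw [prodOp_mul]
    rw [this, ← Matrix.mulVec_mulVec, hK, Matrix.mulVec_smul, Matrix.mulVec_mulVec, prodOp_mul]
    simp only [← Units.val_mul, inv_mul_cancel, Units.val_one, prodOp_one, Matrix.one_mulVec]
  -- The scalar `c⁻¹` is absorbed into the factor of the single party `j₀`, which turns `T ψ = c ψ`
  -- into a symmetry of `ψ`.
  let cU : GL d ℂ := ⟨c⁻¹ • 1, c • 1, by simp [hc], by simp [hc]⟩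
  have hM : prodOp (Function.update T j₀ (c⁻¹ • T j₀)) = c⁻¹ • prodOp T := prodOp_smul_at T j₀ c⁻¹
  refine ⟨c⁻¹ • prodOp T, ⟨Function.update (fun j => (H j)⁻¹ * G j) j₀
    (cU * ((H j₀)⁻¹ * G j₀)), ?_, ?_⟩, ?_⟩
  · rw [← hM]
    congr 1
    ext1 j
    by_cases hj : j = j₀
    · rw [hj]; simp [cU, T, G]
    · simp [hj, T, G]
  · rw [Matrix.smul_mulVec, hTψ, smul_smul, inv_mul_cancel₀ hc, one_smul]
  · rw [Matrix.mul_smul, smul_smul, mul_inv_cancel₀ hc, one_smul, hHT]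

end Stabilizers

end MultiState

/-! ### Optimal transformations of one and of two copies -/

namespace MultiState

section General

variable {ι d : Type} [Fintype ι] [DecidableEq ι] [Fintype d] [DecidableEq d]

theorem density_transform {M : Op ι d} {ψ φ : Ket ι d} {c : ℂ} (hφ : φ ≠ 0)
    (h : M *ᵥ ψ = c • φ) : M * density ψ * Mᴴ =
      ((‖c‖ ^ 2 * ketNorm φ ^ 2 / ketNorm ψ ^ 2 : ℝ) : ℂ) • density φ := by
  have hφ0 : ((ketNorm φ : ℝ) : ℂ) ≠ 0 := by exact_mod_cast ketNorm_ne_zero.mpr hφ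
  rw [mul_density_mul_conjTranspose, h, density, star_smul, Matrix.smul_vecMulVec,
    Matrix.vecMulVec_smul, smul_smul, smul_smul, smul_smul]
  congr 1
  push_cast
  rw [← Complex.mul_conj', Complex.star_def]
  field_simp

theorem trace_mul_single_mul_conjTranspose (M : Op ι d) (x : ι → d) :
    (M * Matrix.single x x 1 * Mᴴ).trace = (Mᴴ * M) x x := by
  rw [Matrix.trace_mul_comm, ← mul_assoc, Matrix.trace_mul_comm, Matrix.trace_single_mul]
  simp

theorem conjTranspose_mul_self_smul (c : ℂ) (M : Op ι d) :
    (c • M)ᴴ * (c • M) = ((‖c‖ ^ 2 : ℝ) : ℂ) • (Mᴴ * M) := by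
  rw [Matrix.conjTranspose_smul, Matrix.smul_mul, Matrix.mul_smul, smul_smul, Complex.star_def,
    Complex.conj_mul']
  push_cast
  rfl

theorem posSemidef_single (x : ι → d) : (Matrix.single x x 1 : Op ι d).PosSemidef := by
  rw [← Matrix.diagonal_single]
  exact Matrix.PosSemidef.diagonal (Pi.single_nonneg.mpr zero_le_one)

theorem trace_mul_mul_conjTranspose_nonneg (M : Op ι d) {W : Op ι d} (hW : W.PosSemidef) :
    0 ≤ (M * W * Mᴴ).trace.re :=
  (Complex.le_def.mp (hW.mul_mul_conjTranspose_same M).trace_nonneg).1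

theorem prodOp_kronecker_apply (A B : LocalOps ι d) (x y : ι → d × d) :
    prodOp (fun j => A j ⊗ₖ B j) x y =
      prodOp A (fun j => (x j).1) (fun j => (y j).1) *
        prodOp B (fun j => (x j).2) (fun j => (y j).2) := by
  simp only [prodOp_apply, Matrix.kroneckerMap_apply, Finset.prod_mul_distrib]

theorem ketTensor_ne_zero {ψ φ : Ket ι d} (hψ : ψ ≠ 0) (hφ : φ ≠ 0) : ketTensor ψ φ ≠ 0 := by
  rw [← ketNorm_ne_zero, ketNorm_ketTensor]
  exact mul_ne_zero (ketNorm_ne_zero.mpr hψ) (ketNorm_ne_zero.mpr hφ)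

/-- If two copies of a state have no further symmetry than the exchange of the copies, then the
state itself has no symmetry. -/
theorem eq_one_of_mem_stabilizer [Nonempty ι] [Nontrivial d] {ψ : Ket ι d}
    (h : stabilizer (ketTensor ψ ψ) ⊆ {1, globalSwap}) {M : Op ι d} (hM : M ∈ stabilizer ψ) :
    M = 1 := by
  obtain ⟨S, rfl, hS⟩ := hM
  have hmem : prodOp (fun j => (S j : Matrix d d ℂ) ⊗ₖ (1 : Matrix d d ℂ)) ∈
      stabilizer (ketTensor ψ ψ) := by
    refine ⟨fun j => ⟨(S j : Matrix d d ℂ) ⊗ₖ 1, ((S j)⁻¹ : GL d ℂ) ⊗ₖ 1, ?_, ?_⟩, rfl, ?_⟩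
    · rw [← Matrix.mul_kronecker_mul, ← Units.val_mul, mul_inv_cancel, Units.val_one, one_mul,
        Matrix.one_kronecker_one]
    · rw [← Matrix.mul_kronecker_mul, ← Units.val_mul, inv_mul_cancel, Units.val_one, one_mul,
        Matrix.one_kronecker_one]
    · rw [prodOp_kronecker_mulVec, hS, prodOp_one, Matrix.one_mulVec]
  obtain ⟨a, b, hab⟩ := exists_pair_ne d
  rcases h hmem with h1 | h1
  · ext x y
    have := congrFun (congrFun h1 fun j => (x j, a)) fun j => (y j, a)
    rw [prodOp_kronecker_apply, prodOp_one, Matrix.one_apply_eq, mul_one] at this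
    rw [this, Matrix.one_apply, Matrix.one_apply]
    congr 1
    simp [funext_iff]
  -- `S ⊗ 1` cannot be the flip: its entry between `(a, b)` and `(b, a)` at every party contains an
  -- off-diagonal entry of the identity on the second copy, while the flip has the entry 1 there.
  · have := congrFun (congrFun (Set.mem_singleton_iff.mp h1) fun _ => (a, b)) fun _ => (b, a)
    rw [prodOp_kronecker_apply, prodOp_one, globalSwap_apply, Matrix.one_apply_ne, mul_zero] at this
    · simp at this
    · intro h
      exact hab (congrFun h (Classical.arbitrary ι)).symm

/-- In one branch of a protocol, all parties apply the same isometry. -/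
theorem reflTransGen_apply_isometry {u : Matrix d d ℂ} (hu : uᴴ * u = 1) (K : LocalOps ι d)
    (L : Multiset (LocalOps ι d)) :
    Relation.ReflTransGen LOCCStep (K ::ₘ L) ((fun j => u * K j) ::ₘ L) := by
  have key : ∀ s : Finset ι, Relation.ReflTransGen LOCCStep (K ::ₘ L)
      ((fun j => if j ∈ s then u * K j else K j) ::ₘ L) := by
    intro s
    induction s using Finset.induction_on with
    | empty => simpa using Relation.ReflTransGen.refl
    | insert i s hi ih =>
      refine ih.tail ?_
      have := LOCCStep.measure L (fun j => if j ∈ s then u * K j else K j) i {u} (by simpa using hu)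
      rw [Multiset.map_singleton, Multiset.singleton_add] at this
      convert this using 2
      ext1 j
      by_cases hj : j = i
      · subst hj; simp [hi]
      · simp [hj]
  simpa using key Finset.univ

end General

section LastParty

variable {d : Type} [Fintype d] [DecidableEq d] {n : ℕ}

theorem isProtocol_onLast (A : Multiset (Matrix d d ℂ)) (hA : (A.map fun a => aᴴ * a).sum = 1) :
    IsProtocol (A.map (onLast (n := n))) := by
  have := LOCCStep.measure 0 (fun _ : Fin (n + 1) => (1 : Matrix d d ℂ)) (Fin.last n) A hA
  simp only [mul_one, add_zero] at this
  exact Relation.ReflTransGen.single this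

theorem conjTranspose_mul_self_onLast_apply (h : Matrix d d ℂ) (x : Fin (n + 1) → d) :
    ((prodOp (onLast h))ᴴ * prodOp (onLast h) : Op (Fin (n + 1)) d) x x = (hᴴ * h) (x (Fin.last n)) (x (Fin.last n)) := by
  have : (fun j => (onLast h j)ᴴ * onLast h j) =
      Function.update (fun _ : Fin (n + 1) => (1 : Matrix d d ℂ)) (Fin.last n) (hᴴ * h) := by
    ext1 j
    by_cases hj : j = Fin.last n
    · subst hj; simp [onLast]
    · simp [onLast, hj]
  rw [conjTranspose_mul_self_prodOp, this, prodOp_update_apply]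
  simp

theorem onLast_kronecker (a b : Matrix d d ℂ) (j : Fin (n + 1)) :
    onLast (a ⊗ₖ b) j = onLast a j ⊗ₖ onLast b j := by
  by_cases hj : j = Fin.last n
  · subst hj; simp [onLast]
  · simp [onLast, hj]

theorem prodOp_onLast_kronecker_mulVec (a b : Matrix d d ℂ) (ψ φ : Ket (Fin (n + 1)) d) :
    prodOp (onLast (a ⊗ₖ b)) *ᵥ ketTensor ψ φ = ketTensor (applyLast a ψ) (applyLast b φ) := by
  rw [applyLast, applyLast, ← prodOp_kronecker_mulVec]
  congr 2
  exact funext fun j => onLast_kronecker a b j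

/-- The local operators `1 ⊗ ⋯ ⊗ 1 ⊗ h` for an invertible `h`. -/
def onLastGL (h : GL d ℂ) : Fin (n + 1) → GL d ℂ := Function.update (fun _ => 1) (Fin.last n) h

theorem coe_onLastGL (h : GL d ℂ) :
    (fun j => (onLastGL (n := n) h j : Matrix d d ℂ)) = onLast (h : Matrix d d ℂ) := by
  ext1 j
  by_cases hj : j = Fin.last n
  · subst hj; simp [onLast, onLastGL]
  · simp [onLast, onLastGL, hj]

theorem applyLast_ne_zero {h : Matrix d d ℂ} (hh : h.det ≠ 0) {ψ : Ket (Fin (n + 1)) d}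
    (hψ : ψ ≠ 0) : applyLast h ψ ≠ 0 := by
  intro h0
  apply hψ
  let g := Matrix.GeneralLinearGroup.mkOfDetNeZero h hh
  have h1 : prodOp (fun j => (((onLastGL (n := n) g j)⁻¹ : GL d ℂ) : Matrix d d ℂ)) *
      prodOp (onLast (n := n) h) = 1 := by
    rw [show h = (g : Matrix d d ℂ) from rfl, ← coe_onLastGL, prodOp_mul]
    simp only [← Units.val_mul, inv_mul_cancel, Units.val_one, prodOp_one]
  rw [← Matrix.one_mulVec ψ, ← h1, ← Matrix.mulVec_mulVec]
  rw [applyLast] at h0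
  rw [h0, Matrix.mulVec_zero]

/-- A state without symmetries is transformed optimally into `(1 ⊗ ⋯ ⊗ 1 ⊗ h)|ψ⟩` by the
measurement of which `h` is the successful outcome. -/
theorem isMaxProb_applyLast {ψ : Ket (Fin (n + 1)) d} (hψ : ketNorm ψ = 1)
    (hstab : ∀ M ∈ stabilizer ψ, M = 1) {h b : Matrix d d ℂ} (hh : h.det ≠ 0)
    (hb : hᴴ * h + bᴴ * b = 1) (a : d) (ha : (hᴴ * h) a a = 1) :
    IsMaxProb ψ (applyLast h ψ) (ketNorm (applyLast h ψ) ^ 2) := by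
  have hψ0 : ψ ≠ 0 := ketNorm_ne_zero.mp (by rw [hψ]; exact one_ne_zero)
  have hφ0 := applyLast_ne_zero hh hψ0
  let g := Matrix.GeneralLinearGroup.mkOfDetNeZero h hh
  -- Here `K` must be `c` times `h` on the last party, so `tr(K W K†) = |c|² (h†h)_{aa} = |c|²`.
  refine isMaxProb_of hψ0 hφ0 (posSemidef_single fun _ => a) one_pos ?_ ?_
    (S := {onLast h}) (F := {onLast b}) ?_ ?_
  · intro K c hK
    rcases eq_or_ne c 0 with rfl | hc
    · simpa using trace_mul_mul_conjTranspose_nonneg (prodOp K) (posSemidef_single fun _ => a)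
    obtain ⟨M, hM, hKM⟩ := exists_mem_stabilizer_of_mulVec_eq_smul
      (fun M hM => by rw [hstab M hM, one_mul]) (onLastGL g) hc (K := K)
      (by rw [coe_onLastGL]; exact hK)
    rw [hstab M hM, mul_one, coe_onLastGL] at hKM
    rw [trace_mul_single_mul_conjTranspose, hKM, conjTranspose_mul_self_smul, Matrix.smul_apply,
      conjTranspose_mul_self_onLast_apply, show (g : Matrix d d ℂ) = h from rfl, ha, smul_eq_mul,
      mul_one, Complex.ofReal_re, one_mul]
  · simp [hψ]
  · have := isProtocol_onLast (n := n) {h, b} (by simpa using hb)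
    simpa using this
  · rw [krausMap, Multiset.map_singleton, Multiset.sum_singleton,
      density_transform (c := 1) hφ0 (by rw [one_smul, applyLast]), hψ]
    simp

end LastParty

section Qubits

variable {n : ℕ} {ε : ℝ} {h₁ h₂ : Matrix (Fin 2) (Fin 2) ℂ}

theorem measOp_conjTranspose_mul_self (a b : Matrix (Fin 2) (Fin 2) ℂ) :
    (measOp ε a b)ᴴ * measOp ε a b = ((1 / (1 + ε ^ 2) : ℝ) : ℂ) • ((aᴴ * a) ⊗ₖ (bᴴ * b)) := by
  rw [measOp, Matrix.conjTranspose_smul, Matrix.smul_mul, Matrix.mul_smul, smul_smul,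
    Complex.star_def, Complex.conj_ofReal, ← Complex.ofReal_mul,
    Real.mul_self_sqrt (by positivity), Matrix.conjTranspose_kronecker, Matrix.mul_kronecker_mul]

/-- The failing measurement operator of the protocol. -/
noncomputable def failOp (ε : ℝ) : Matrix (Fin 2 × Fin 2) (Fin 2 × Fin 2) ℂ :=
  Matrix.diagonal fun q => if q.1 = q.2 then ((√(1 - 2 * ε / (1 + ε ^ 2)) : ℝ) : ℂ) else 0

theorem failOp_posSemidef (ε : ℝ) : (failOp ε).PosSemidef := by
  refine Matrix.PosSemidef.diagonal fun q => ?_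
  dsimp only [Pi.zero_apply]
  split_ifs
  · exact_mod_cast Real.sqrt_nonneg _
  · exact le_rfl

/-- The two successful effects add up to a diagonal operator: it is 1 on `|01⟩` and `|10⟩`, and `2ε
/ (1 + ε²) ≤ 1` on `|00⟩` and `|11⟩`. -/
theorem failOp_mul_self (h1 : h₁ᴴ * h₁ = diagOne ε) (h2 : h₂ᴴ * h₂ = diagTwo ε) :
    failOp ε * failOp ε = 1 - ((measOp ε h₁ h₂)ᴴ * measOp ε h₁ h₂ +
      (measOp ε h₂ h₁)ᴴ * measOp ε h₂ h₁) := by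
  have hpos : 0 < 1 + ε ^ 2 := by positivity
  have hs : ((√(1 - 2 * ε / (1 + ε ^ 2)) : ℝ) : ℂ) * ((√(1 - 2 * ε / (1 + ε ^ 2)) : ℝ) : ℂ) =
      1 - 2 * ε / (1 + ε ^ 2) := by
    rw [← Complex.ofReal_mul, Real.mul_self_sqrt]
    · push_cast; ring
    · rw [sub_nonneg, div_le_one hpos]
      nlinarith [sq_nonneg (1 - ε)]
  have hne : (1 + (ε : ℂ) ^ 2) ≠ 0 := by exact_mod_cast hpos.ne'
  rw [measOp_conjTranspose_mul_self, measOp_conjTranspose_mul_self, h1, h2, failOp,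
    Matrix.diagonal_mul_diagonal]
  ext ⟨i, j⟩ ⟨k, l⟩
  fin_cases i <;> fin_cases j <;> fin_cases k <;> fin_cases l <;>
    simp [diagOne, diagTwo, hs] <;> field_simp <;> ring

theorem det_ne_zero_of_conjTranspose_mul_self {h D : Matrix (Fin 2) (Fin 2) ℂ} (hD : D.det ≠ 0)
    (h' : hᴴ * h = D) : h.det ≠ 0 := by
  intro h0
  rw [← h', Matrix.det_mul, h0, mul_zero] at hD
  exact hD rfl

theorem det_diagOne (hε : 0 < ε) : (diagOne ε).det ≠ 0 := by
  simp [diagOne, Matrix.det_fin_two, hε.ne']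

theorem det_diagTwo (hε : 0 < ε) : (diagTwo ε).det ≠ 0 := by
  simp [diagTwo, Matrix.det_fin_two, hε.ne']

theorem isMaxProb_applyLast_diagOne {ψ : Ket (Fin (n + 1)) (Fin 2)} (hψ : ketNorm ψ = 1)
    (hstab : ∀ M ∈ stabilizer ψ, M = 1) (hε : 0 < ε) (hε1 : ε < 1)
    (h1 : h₁ᴴ * h₁ = diagOne ε) :
    IsMaxProb ψ (applyLast h₁ ψ) (ketNorm (applyLast h₁ ψ) ^ 2) := by
  have hs : ((√(1 - ε) : ℝ) : ℂ) * ((√(1 - ε) : ℝ) : ℂ) = 1 - ε := by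
    rw [← Complex.ofReal_mul, Real.mul_self_sqrt (by linarith)]
    push_cast; ring
  refine isMaxProb_applyLast hψ hstab
    (det_ne_zero_of_conjTranspose_mul_self (det_diagOne hε) h1)
    (b := !![0, 0; 0, ((√(1 - ε) : ℝ) : ℂ)]) ?_ 0 (by simp [h1, diagOne])
  rw [h1]
  ext i j
  fin_cases i <;> fin_cases j <;> simp [diagOne, Matrix.mul_apply, hs]

theorem isMaxProb_applyLast_diagTwo {ψ : Ket (Fin (n + 1)) (Fin 2)} (hψ : ketNorm ψ = 1)
    (hstab : ∀ M ∈ stabilizer ψ, M = 1) (hε : 0 < ε) (hε1 : ε < 1)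
    (h2 : h₂ᴴ * h₂ = diagTwo ε) :
    IsMaxProb ψ (applyLast h₂ ψ) (ketNorm (applyLast h₂ ψ) ^ 2) := by
  have hs : ((√(1 - ε) : ℝ) : ℂ) * ((√(1 - ε) : ℝ) : ℂ) = 1 - ε := by
    rw [← Complex.ofReal_mul, Real.mul_self_sqrt (by linarith)]
    push_cast; ring
  refine isMaxProb_applyLast hψ hstab
    (det_ne_zero_of_conjTranspose_mul_self (det_diagTwo hε) h2)
    (b := !![((√(1 - ε) : ℝ) : ℂ), 0; 0, 0]) ?_ 1 (by simp [h2, diagTwo])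
  rw [h2]
  ext i j
  fin_cases i <;> fin_cases j <;> simp [diagTwo, Matrix.mul_apply, hs]

theorem isProtocol_protocolSuccess (h1 : h₁ᴴ * h₁ = diagOne ε) (h2 : h₂ᴴ * h₂ = diagTwo ε) :
    IsProtocol (protocolSuccess n ε h₁ h₂ + {onLast (failOp ε)}) := by
  have hA : (({measOp ε h₁ h₂, measOp ε h₂ h₁, failOp ε} :
      Multiset (Matrix (Fin 2 × Fin 2) (Fin 2 × Fin 2) ℂ)).map fun a => aᴴ * a).sum = 1 := by
    have : (failOp ε)ᴴ * failOp ε = 1 - ((measOp ε h₁ h₂)ᴴ * measOp ε h₁ h₂ +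
        (measOp ε h₂ h₁)ᴴ * measOp ε h₂ h₁) := by
      rw [(failOp_posSemidef ε).1.eq, failOp_mul_self h1 h2]
    simp only [Multiset.insert_eq_cons, Multiset.map_cons, Multiset.sum_cons,
      Multiset.map_singleton, Multiset.sum_singleton, this]
    abel
  have hstep := isProtocol_onLast (n := n) _ hA
  have hswap := reflTransGen_apply_isometry (u := localSwap)
    (by rw [localSwap_conjTranspose, localSwap_mul_self])
    (onLast (n := n) (measOp ε h₂ h₁)) {onLast (measOp ε h₁ h₂), onLast (failOp ε)}
  simp only [Multiset.insert_eq_cons, Multiset.map_cons, Multiset.map_singleton] at hstep hswap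
  rw [Multiset.cons_swap] at hstep
  have := Relation.ReflTransGen.trans hstep hswap
  rw [Multiset.cons_swap] at this
  exact this

theorem prodOp_onLast_measOp_mulVec (a b : Matrix (Fin 2) (Fin 2) ℂ)
    (ψ : Ket (Fin (n + 1)) (Fin 2)) :
    prodOp (onLast (measOp ε a b)) *ᵥ ketTensor ψ ψ =
      ((√(1 / (1 + ε ^ 2)) : ℝ) : ℂ) • ketTensor (applyLast a ψ) (applyLast b ψ) := by
  have h := map_smul (prodOpAt (fun _ : Fin (n + 1) => (1 : Matrix (Fin 2 × Fin 2) _ ℂ))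
    (Fin.last n)) ((√(1 / (1 + ε ^ 2)) : ℝ) : ℂ) (a ⊗ₖ b)
  rw [prodOpAt_apply, prodOpAt_apply] at h
  change prodOp (onLast (measOp ε a b)) = _ • prodOp (onLast (a ⊗ₖ b)) at h
  rw [h, Matrix.smul_mulVec, prodOp_onLast_kronecker_mulVec]

theorem krausMap_protocolSuccess {ψ : Ket (Fin (n + 1)) (Fin 2)} (hψ : ketNorm ψ = 1)
    (hφ : ketTensor (applyLast h₁ ψ) (applyLast h₂ ψ) ≠ 0) :
    krausMap (protocolSuccess n ε h₁ h₂) (density (ketTensor ψ ψ)) =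
      ((2 / (1 + ε ^ 2) * (ketNorm (applyLast h₁ ψ) ^ 2 * ketNorm (applyLast h₂ ψ) ^ 2) : ℝ) : ℂ) •
        density (ketTensor (applyLast h₁ ψ) (applyLast h₂ ψ)) := by
  have h2 : prodOp (fun j => localSwap * (onLast (measOp ε h₂ h₁) : LocalOps (Fin (n + 1)) _) j) *ᵥ
      ketTensor ψ ψ = ((√(1 / (1 + ε ^ 2)) : ℝ) : ℂ) •
        ketTensor (applyLast h₁ ψ) (applyLast h₂ ψ) := by
    rw [← prodOp_mul, ← globalSwap, ← Matrix.mulVec_mulVec, prodOp_onLast_measOp_mulVec,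
      Matrix.mulVec_smul, globalSwap_mulVec_ketTensor]
  rw [protocolSuccess, Multiset.insert_eq_cons, krausMap_cons,
    density_transform hφ (prodOp_onLast_measOp_mulVec h₁ h₂ ψ), krausMap, Multiset.map_singleton,
    Multiset.sum_singleton, density_transform hφ h2, ← add_smul, ← Complex.ofReal_add]
  congr 2
  rw [Complex.norm_real, Real.norm_of_nonneg (Real.sqrt_nonneg _), Real.sq_sqrt (by positivity),
    ketNorm_ketTensor, ketNorm_ketTensor, hψ]
  field_simp
  ring

theorem globalSwap_conj_apply {ι d : Type} [Fintype ι] [DecidableEq ι] [Fintype d] [DecidableEq d]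
    (X : Op ι (d × d)) (x : ι → d × d) :
    (globalSwapᴴ * X * globalSwap : Op ι (d × d)) x x = X (fun j => (x j).swap) (fun j => (x j).swap) := by
  have h : (globalSwap : Op ι (d × d))ᴴ = globalSwap := by
    rw [globalSwap, conjTranspose_prodOp]
    simp only [localSwap_conjTranspose]
  rw [h, Matrix.mul_apply, Finset.sum_eq_single fun j => (x j).swap]
  · rw [globalSwap_apply, if_pos rfl, mul_one, Matrix.mul_apply,
      Finset.sum_eq_single fun j => (x j).swap]
    · rw [globalSwap_apply, if_pos (by simp), one_mul]
    · rintro y - hy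
      rw [globalSwap_apply, if_neg, zero_mul]
      rintro rfl
      simp at hy
    · simp
  · rintro y - hy
    rw [globalSwap_apply, if_neg (Ne.symm hy), mul_zero]
  · simp

theorem isMaxProb_two_copies {ψ : Ket (Fin (n + 1)) (Fin 2)} (hψ : ketNorm ψ = 1)
    (hstab : stabilizer (ketTensor ψ ψ) = {1, globalSwap}) (hε : 0 < ε)
    (h1 : h₁ᴴ * h₁ = diagOne ε) (h2 : h₂ᴴ * h₂ = diagTwo ε) :
    IsMaxProb (ketTensor ψ ψ) (ketTensor (applyLast h₁ ψ) (applyLast h₂ ψ))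
      (2 / (1 + ε ^ 2) * (ketNorm (applyLast h₁ ψ) ^ 2 * ketNorm (applyLast h₂ ψ) ^ 2)) := by
  have hψ0 : ψ ≠ 0 := ketNorm_ne_zero.mp (by rw [hψ]; exact one_ne_zero)
  have hd1 := det_ne_zero_of_conjTranspose_mul_self (det_diagOne hε) h1
  have hd2 := det_ne_zero_of_conjTranspose_mul_self (det_diagTwo hε) h2
  have hφ0 := ketTensor_ne_zero (applyLast_ne_zero hd1 hψ0) (applyLast_ne_zero hd2 hψ0)
  have hd : (h₁ ⊗ₖ h₂).det ≠ 0 := by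
    rw [Matrix.det_kronecker]
    exact mul_ne_zero (pow_ne_zero _ hd1) (pow_ne_zero _ hd2)
  let g := Matrix.GeneralLinearGroup.mkOfDetNeZero _ hd
  have hpos : 0 < 1 + ε ^ 2 := by positivity
  -- Exchanging the copies permutes the two projectors. Thus both symmetries, 1 and SWAP, give the
  -- same value `|c|² (1 + ε²)`, and the certificate is tight.
  have hW := (posSemidef_single fun _ : Fin (n + 1) => ((0, 1) : Fin 2 × Fin 2)).add
    (posSemidef_single fun _ : Fin (n + 1) => ((1, 0) : Fin 2 × Fin 2))
  refine isMaxProb_of (ketTensor_ne_zero hψ0 hψ0) hφ0 hW hpos ?_ ?_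
    (isProtocol_protocolSuccess h1 h2) (krausMap_protocolSuccess hψ hφ0)
  · intro K c hK
    rcases eq_or_ne c 0 with rfl | hc
    · simpa using trace_mul_mul_conjTranspose_nonneg (prodOp K) hW
    have hsq : ∀ M ∈ stabilizer (ketTensor ψ ψ), M * M = 1 := by
      intro M hM
      rw [hstab] at hM
      rcases hM with rfl | hM
      · exact one_mul 1
      · rw [Set.mem_singleton_iff.mp hM, globalSwap_mul_self]
    obtain ⟨M, hM, hKM⟩ := exists_mem_stabilizer_of_mulVec_eq_smul hsq (onLastGL g) hc (K := K)
      (by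
        rw [coe_onLastGL, show (g : Matrix _ _ ℂ) = h₁ ⊗ₖ h₂ from rfl,
          prodOp_onLast_kronecker_mulVec]
        exact hK)
    rw [coe_onLastGL, show (g : Matrix _ _ ℂ) = h₁ ⊗ₖ h₂ from rfl] at hKM
    have hH : ∀ x : Fin (n + 1) → Fin 2 × Fin 2,
        ((prodOp (onLast (h₁ ⊗ₖ h₂)))ᴴ * prodOp (onLast (h₁ ⊗ₖ h₂)) : Op (Fin (n + 1)) _) x x =
          (diagOne ε ⊗ₖ diagTwo ε) (x (Fin.last n)) (x (Fin.last n)) := fun x => by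
      rw [conjTranspose_mul_self_onLast_apply, Matrix.conjTranspose_kronecker,
        ← Matrix.mul_kronecker_mul, h1, h2]
    rw [Matrix.mul_add, Matrix.add_mul, Matrix.trace_add, trace_mul_single_mul_conjTranspose,
      trace_mul_single_mul_conjTranspose, hKM, conjTranspose_mul_self_smul, Matrix.smul_apply,
      Matrix.smul_apply, ← smul_add, smul_eq_mul, Complex.re_ofReal_mul, mul_comm]
    refine le_of_eq (congrArg _ ?_)
    rw [hstab] at hM
    rcases hM with rfl | hM
    · rw [mul_one, hH, hH]
      simp [diagOne, diagTwo, sq]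
    · rw [Set.mem_singleton_iff.mp hM, Matrix.conjTranspose_mul, mul_assoc globalSwapᴴ,
        ← mul_assoc _ _ globalSwap, ← mul_assoc globalSwapᴴ, globalSwap_conj_apply,
        globalSwap_conj_apply, hH, hH]
      simp [diagOne, diagTwo, sq, add_comm]
  · rw [ketNorm_ketTensor, ketNorm_ketTensor, hψ, Matrix.trace_add, Matrix.trace_single_eq_same,
      Matrix.trace_single_eq_same]
    norm_num
    field_simp

end Qubits

end MultiState

/-! ### Two-party consequences of permutation invariance -/

namespace MultiState

section TwoParties

variable {ι d : Type} [Fintype ι] [DecidableEq ι] [Fintype d] [DecidableEq d]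

theorem prodOp_update_one_mulVec (j : ι) (a : Matrix d d ℂ) (ψ : Ket ι d) (x : ι → d) :
    (prodOp (Function.update (fun _ => 1) j a) *ᵥ ψ) x =
      ∑ b, a (x j) b * ψ (Function.update x j b) := by
  refine (Fintype.sum_of_injective (fun b => Function.update x j b)
    (Function.update_injective x j) _ _ ?_ ?_).symm
  · intro y hy
    dsimp only
    rw [prodOp_update_apply]
    have : ∃ k ∈ Finset.univ.erase j, (1 : Matrix d d ℂ) (x k) (y k) = 0 := by
      by_contra! h
      refine hy ⟨y j, ?_⟩
      ext1 k
      by_cases hk : k = j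
      · subst hk; simp
      · have := h k (by simp [hk])
        by_contra hne
        dsimp only at hne
        rw [Function.update_of_ne hk] at hne
        exact this (Matrix.one_apply_ne hne)
    obtain ⟨k, hk, hk0⟩ := this
    rw [Finset.prod_eq_zero hk hk0, mul_zero, zero_mul]
  · intro b
    dsimp only
    rw [prodOp_update_apply, Function.update_self, Finset.prod_eq_one, mul_one]
    intro k hk
    rw [Function.update_of_ne (Finset.ne_of_mem_erase hk), Matrix.one_apply_eq]

theorem prodOp_update_update_one_mulVec {i j : ι} (hij : i ≠ j) (a b : Matrix d d ℂ)
    (ψ : Ket ι d) (x : ι → d) :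
    (prodOp (Function.update (Function.update (fun _ => 1) i a) j b) *ᵥ ψ) x =
      ∑ y, ∑ z, a (x i) y * (b (x j) z *
        ψ (Function.update (Function.update x i y) j z)) := by
  have h : prodOp (Function.update (Function.update (fun _ => 1) i a) j b) =
      prodOp (Function.update (fun _ => 1) i a) * prodOp (Function.update (fun _ => 1) j b) := by
    rw [prodOp_mul]
    congr 1
    ext1 k
    by_cases hk : k = j
    · subst hk; simp [hij.symm]
    · simp [hk]
  rw [h, ← Matrix.mulVec_mulVec, prodOp_update_one_mulVec]
  refine Finset.sum_congr rfl fun y _ => ?_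
  rw [prodOp_update_one_mulVec, Finset.mul_sum, Function.update_of_ne hij.symm]

theorem mulVec_apply_of_invariant {M : Op ι d} {ψ : Ket ι d} (τ : (ι → d) ≃ (ι → d))
    (hM : ∀ x y, M (τ x) (τ y) = M x y) (hψ : ∀ x, ψ (τ x) = ψ x) (x : ι → d) :
    (M *ᵥ ψ) (τ x) = (M *ᵥ ψ) x := by
  simp only [Matrix.mulVec, dotProduct]
  rw [← τ.sum_comp]
  simp only [hM, hψ]

/-- Exchange the first components held by parties `i` and `j`. -/
def swapFst (i j : ι) : (ι → d × d) ≃ (ι → d × d) where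
  toFun x k := ((x (Equiv.swap i j k)).1, (x k).2)
  invFun x k := ((x (Equiv.swap i j k)).1, (x k).2)
  left_inv x := by simp
  right_inv x := by simp

/-- Exchange the second components held by parties `i` and `j`. -/
def swapSnd (i j : ι) : (ι → d × d) ≃ (ι → d × d) where
  toFun x k := ((x k).1, (x (Equiv.swap i j k)).2)
  invFun x k := ((x k).1, (x (Equiv.swap i j k)).2)
  left_inv x := by simp
  right_inv x := by simp

theorem prod_eq_mul_mul_prod {i j : ι} (hij : i ≠ j) (f : ι → ℂ) :
    ∏ k, f k = f i * (f j * ∏ k ∈ (Finset.univ.erase i).erase j, f k) := by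
  rw [Finset.mul_prod_erase _ _ (by simp [hij.symm]), Finset.mul_prod_erase _ _ (by simp)]

theorem prodOp_swapFst {i j : ι} (hij : i ≠ j) {K : LocalOps ι (d × d)} (hi : K i = 1)
    (hj : K j = 1) (x y : ι → d × d) :
    prodOp K (swapFst i j x) (swapFst i j y) = prodOp K x y := by
  rw [prodOp_apply, prodOp_apply, prod_eq_mul_mul_prod hij, prod_eq_mul_mul_prod hij]
  rw [← mul_assoc, ← mul_assoc]
  congr 1
  · rw [hi, hj]
    simp only [swapFst, Equiv.coe_fn_mk, Equiv.swap_apply_left, Equiv.swap_apply_right,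
      Matrix.one_apply, Prod.ext_iff]
    split_ifs <;> simp_all
  · refine Finset.prod_congr rfl fun k hk => ?_
    simp only [Finset.mem_erase, Finset.mem_univ, and_true] at hk
    simp only [swapFst, Equiv.coe_fn_mk, Equiv.swap_apply_of_ne_of_ne hk.2 hk.1]

theorem prodOp_swapSnd {i j : ι} (hij : i ≠ j) {K : LocalOps ι (d × d)} (hi : K i = 1)
    (hj : K j = 1) (x y : ι → d × d) :
    prodOp K (swapSnd i j x) (swapSnd i j y) = prodOp K x y := by
  rw [prodOp_apply, prodOp_apply, prod_eq_mul_mul_prod hij, prod_eq_mul_mul_prod hij]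
  rw [← mul_assoc, ← mul_assoc]
  congr 1
  · rw [hi, hj]
    simp only [swapSnd, Equiv.coe_fn_mk, Equiv.swap_apply_left, Equiv.swap_apply_right,
      Matrix.one_apply, Prod.ext_iff]
    split_ifs <;> simp_all
  · refine Finset.prod_congr rfl fun k hk => ?_
    simp only [Finset.mem_erase, Finset.mem_univ, and_true] at hk
    simp only [swapSnd, Equiv.coe_fn_mk, Equiv.swap_apply_of_ne_of_ne hk.2 hk.1]

/-- The action of a symmetry on two parties can be undone on the other parties. -/
theorem exists_prodOp_update_update_mulVec_eq {i j : ι} {S : ι → GL d ℂ} {ψ : Ket ι d}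
    (hS : prodOp (fun k => (S k : Matrix d d ℂ)) *ᵥ ψ = ψ) :
    ∃ K : LocalOps ι d, K i = 1 ∧ K j = 1 ∧
      prodOp (Function.update (Function.update (fun _ => 1) i (S i : Matrix d d ℂ)) j
        (S j : Matrix d d ℂ)) *ᵥ ψ = prodOp K *ᵥ ψ := by
  refine ⟨fun k => if k = i ∨ k = j then 1 else ((S k)⁻¹ : GL d ℂ), by simp, by simp, ?_⟩
  conv_rhs => rw [← hS]
  rw [Matrix.mulVec_mulVec, prodOp_mul]
  congr 2
  ext1 k
  by_cases hk : k = j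
  · subst hk; simp
  · by_cases hk' : k = i
    · subst hk'; simp [hk]
    · simp only [hk, hk', or_self, if_false, ne_eq, not_false_eq_true, Function.update_of_ne]
      rw [← Units.val_mul, inv_mul_cancel, Units.val_one]

/-- Invariance of a function of two pairs under the exchange of their first components and under
the exchange of their second components. -/
def IsBisymmetric (t : d × d → d × d → ℂ) : Prop :=
  ∀ p q, t (q.1, p.2) (p.1, q.2) = t p q ∧ t (p.1, q.2) (q.1, p.2) = t p q

theorem IsBisymmetric.symm {t : d × d → d × d → ℂ} (h : IsBisymmetric t) (p q : d × d) :
    t q p = t p q := by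
  rw [← (h p q).1, ← (h (q.1, p.2) (p.1, q.2)).2]

/-- The vector `(S_i ⊗ S_j)(ψ ⊗ ψ)` also arises from `ψ ⊗ ψ` by operators acting trivially on `i`
and `j`. These commute with exchanging the two parties in one copy only, and `ψ ⊗ ψ` is invariant
under that exchange. The base point `x` fixes the basis states of the remaining parties. -/
theorem isBisymmetric_of_stabilizer {ψ : Ket ι d}
    (hψ : ∀ (σ : Equiv.Perm ι) (x : ι → d), ψ (fun k => x (σ k)) = ψ x) {S : ι → GL (d × d) ℂ}
    (hS : prodOp (fun k => (S k : Matrix (d × d) (d × d) ℂ)) *ᵥ ketTensor ψ ψ = ketTensor ψ ψ)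
    {i j : ι} (hij : i ≠ j) (x : ι → d × d) :
    IsBisymmetric fun p q => ∑ y, ∑ z, S i p y * (S j q z *
        ketTensor ψ ψ (Function.update (Function.update x i y) j z)) := by
  obtain ⟨K, hi, hj, hK⟩ := exists_prodOp_update_update_mulVec_eq (i := i) (j := j) hS
  have hval : ∀ p q : d × d, (∑ y, ∑ z, S i p y * (S j q z *
      ketTensor ψ ψ (Function.update (Function.update x i y) j z))) =
      (prodOp K *ᵥ ketTensor ψ ψ) (Function.update (Function.update x i p) j q) := by
    intro p q
    rw [← hK, prodOp_update_update_one_mulVec hij]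
    simp only [Function.update_self, Function.update_of_ne hij]
    refine Finset.sum_congr rfl fun y _ => Finset.sum_congr rfl fun z _ => ?_
    rw [Function.update_comm hij.symm, Function.update_idem, Function.update_idem]
  intro p q
  constructor
  · dsimp only
    rw [hval, hval, ← mulVec_apply_of_invariant (swapFst i j) (prodOp_swapFst hij hi hj)]
    · congr 1
      ext1 k
      by_cases hk : k = j
      · subst hk; simp [swapFst, hij]
      · by_cases hk' : k = i
        · subst hk'; simp [swapFst, hij]
        · simp [swapFst, hk, hk', Equiv.swap_apply_of_ne_of_ne hk' hk]
    · intro x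
      exact congrArg (· * _) (hψ (Equiv.swap i j) fun k => (x k).1)
  · dsimp only
    rw [hval, hval, ← mulVec_apply_of_invariant (swapSnd i j) (prodOp_swapSnd hij hi hj)]
    · congr 1
      ext1 k
      by_cases hk : k = j
      · subst hk; simp [swapSnd, hij]
      · by_cases hk' : k = i
        · subst hk'; simp [swapSnd, hij]
        · simp [swapSnd, hk, hk', Equiv.swap_apply_of_ne_of_ne hk' hk]
    · intro x
      exact congrArg (_ * ·) (hψ (Equiv.swap i j) fun k => (x k).2)

end TwoParties

/-! ### Determinant preservers on two qubits -/

section KroneckerClassification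

/-- The polarization of the determinant on `2 × 2` matrices. -/
def polarDet (c c' : Fin 2 × Fin 2 → ℂ) : ℂ :=
  c (0, 0) * c' (1, 1) + c (1, 1) * c' (0, 0) - c (0, 1) * c' (1, 0) - c (1, 0) * c' (0, 1)

/-- Up to a factor, the operator preserves the determinant of `2 × 2` matrices. -/
structure PreservesDet (A : Matrix (Fin 2 × Fin 2) (Fin 2 × Fin 2) ℂ) : Prop where
  diag : ∀ a, polarDet (A.col a) (A.col a) = 0
  fst : ∀ i, polarDet (A.col (i, 0)) (A.col (i, 1)) = 0
  snd : ∀ i, polarDet (A.col (0, i)) (A.col (1, i)) = 0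
  cross : polarDet (A.col (0, 0)) (A.col (1, 1)) + polarDet (A.col (0, 1)) (A.col (1, 0)) = 0

/-- With `c` read as a matrix `X`, `P ⊗ Q` acts as `X ↦ P X Qᵀ`, and determinants multiply. -/
theorem polarDet_kronecker_mulVec (P Q : Matrix (Fin 2) (Fin 2) ℂ) (c c' : Fin 2 × Fin 2 → ℂ) :
    polarDet ((P ⊗ₖ Q) *ᵥ c) ((P ⊗ₖ Q) *ᵥ c') = P.det * Q.det * polarDet c c' := by
  simp only [polarDet, Matrix.mulVec, dotProduct, Fintype.sum_prod_type, Fin.sum_univ_two,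
    Matrix.kroneckerMap_apply, Matrix.det_fin_two]
  ring

theorem polarDet_localSwap_mulVec (c c' : Fin 2 × Fin 2 → ℂ) :
    polarDet (localSwap *ᵥ c) (localSwap *ᵥ c') = polarDet c c' := by
  simp only [polarDet, Matrix.mulVec, dotProduct, Fintype.sum_prod_type, Fin.sum_univ_two,
    localSwap, Matrix.of_apply, Prod.swap_prod_mk, Prod.mk.injEq]
  simp
  ring

theorem col_mul (A B : Matrix (Fin 2 × Fin 2) (Fin 2 × Fin 2) ℂ) (a : Fin 2 × Fin 2) :
    (A * B).col a = A *ᵥ B.col a := rfl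

theorem PreservesDet.kronecker_mul {A : Matrix (Fin 2 × Fin 2) (Fin 2 × Fin 2) ℂ}
    (h : PreservesDet A) (P Q : Matrix (Fin 2) (Fin 2) ℂ) : PreservesDet ((P ⊗ₖ Q) * A) where
  diag a := by rw [col_mul, polarDet_kronecker_mulVec, h.diag, mul_zero]
  fst i := by rw [col_mul, col_mul, polarDet_kronecker_mulVec, h.fst, mul_zero]
  snd i := by rw [col_mul, col_mul, polarDet_kronecker_mulVec, h.snd, mul_zero]
  cross := by
    rw [col_mul, col_mul, col_mul, col_mul, polarDet_kronecker_mulVec, polarDet_kronecker_mulVec,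
      ← mul_add, h.cross, mul_zero]

theorem PreservesDet.localSwap_mul {A : Matrix (Fin 2 × Fin 2) (Fin 2 × Fin 2) ℂ}
    (h : PreservesDet A) : PreservesDet (localSwap * A) where
  diag a := by rw [col_mul, polarDet_localSwap_mulVec, h.diag]
  fst i := by rw [col_mul, col_mul, polarDet_localSwap_mulVec, h.fst]
  snd i := by rw [col_mul, col_mul, polarDet_localSwap_mulVec, h.snd]
  cross := by
    rw [col_mul, col_mul, col_mul, col_mul, polarDet_localSwap_mulVec, polarDet_localSwap_mulVec,
      h.cross]

theorem eq_zero_of_mulVec_eq_zero {m : Type*} [Fintype m] [DecidableEq m] {A : Matrix m m ℂ}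
    (hA : A.det ≠ 0) {v : m → ℂ} (h : A *ᵥ v = 0) : v = 0 := by
  by_contra hv
  exact hA (Matrix.exists_mulVec_eq_zero_iff.mp ⟨v, hv, h⟩)

/-- An operator preserving the determinant up to a factor is a product of two local operators if it
fixes the first basis vector and maps its row and its column to themselves. -/
theorem PreservesDet.eq_kronecker {A : Matrix (Fin 2 × Fin 2) (Fin 2 × Fin 2) ℂ}
    (hA : PreservesDet A) (hdet : A.det ≠ 0) (h0 : A.col (0, 0) = Pi.single (0, 0) 1)
    (h1 : A (1, 0) (0, 1) = 0) (h2 : A (0, 1) (1, 0) = 0) :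
    ∃ P Q : Matrix (Fin 2) (Fin 2) ℂ, A = P ⊗ₖ Q := by
  have e00 : A (0, 0) (0, 0) = 1 := by simpa using congrFun h0 (0, 0)
  have e01 : A (0, 1) (0, 0) = 0 := by simpa using congrFun h0 (0, 1)
  have e10 : A (1, 0) (0, 0) = 0 := by simpa using congrFun h0 (1, 0)
  have e11 : A (1, 1) (0, 0) = 0 := by simpa using congrFun h0 (1, 1)
  have f1 := hA.fst 0
  have f2 := hA.fst 1
  have f3 := hA.snd 0
  have f4 := hA.snd 1
  have f5 := hA.cross
  have f6 := hA.diag (1, 1)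
  simp only [polarDet, Matrix.col_apply, e00, e01, e10, e11, h1, h2] at f1 f2 f3 f4 f5 f6
  have g1 : A (1, 1) (0, 1) = 0 := by linear_combination f1
  have g2 : A (1, 1) (1, 0) = 0 := by linear_combination f3
  have hβ : A (0, 1) (0, 1) ≠ 0 := by
    intro h
    have := eq_zero_of_mulVec_eq_zero hdet
      (v := Pi.single (0, 1) 1 - A (0, 0) (0, 1) • Pi.single (0, 0) 1) (by
        rw [Matrix.mulVec_sub, Matrix.mulVec_smul, Matrix.mulVec_single_one,
          Matrix.mulVec_single_one]
        ext ⟨i, j⟩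
        fin_cases i <;> fin_cases j <;> simp [*])
    simpa using congrFun this (0, 1)
  have hγ : A (1, 0) (1, 0) ≠ 0 := by
    intro h
    have := eq_zero_of_mulVec_eq_zero hdet
      (v := Pi.single (1, 0) 1 - A (0, 0) (1, 0) • Pi.single (0, 0) 1) (by
        rw [Matrix.mulVec_sub, Matrix.mulVec_smul, Matrix.mulVec_single_one,
          Matrix.mulVec_single_one]
        ext ⟨i, j⟩
        fin_cases i <;> fin_cases j <;> simp [*])
    simpa using congrFun this (1, 0)
  -- The cross relation fixes the last diagonal entry. The remaining entries of the last column
  -- follow from its orthogonality to the two middle columns and from its being null.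
  have g3 : A (1, 1) (1, 1) = A (0, 1) (0, 1) * A (1, 0) (1, 0) := by
    rw [g1, g2] at f5
    linear_combination f5
  have g4 : A (1, 0) (1, 1) = A (1, 0) (1, 0) * A (0, 0) (0, 1) := by
    refine mul_left_cancel₀ hβ ?_
    rw [g1, g3] at f4
    linear_combination -f4
  have g5 : A (0, 1) (1, 1) = A (0, 1) (0, 1) * A (0, 0) (1, 0) := by
    refine mul_left_cancel₀ hγ ?_
    rw [g2, g3] at f2
    linear_combination -f2
  have g6 : A (0, 0) (1, 1) = A (0, 0) (0, 1) * A (0, 0) (1, 0) := by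
    refine mul_left_cancel₀ (mul_ne_zero hβ hγ) ?_
    rw [g3, g4, g5] at f6
    linear_combination f6 / 2
  refine ⟨!![1, A (0, 0) (1, 0); 0, A (1, 0) (1, 0)], !![1, A (0, 0) (0, 1); 0, A (0, 1) (0, 1)], ?_⟩
  ext ⟨i, j⟩ ⟨k, l⟩
  fin_cases i <;> fin_cases j <;> fin_cases k <;> fin_cases l <;>
    simp [e00, e01, e10, e11, h1, h2, g1, g2, g3, g4, g5, g6, mul_comm]

theorem exists_mulVec_eq_single (u : Fin 2 → ℂ) (hu : u ≠ 0) :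
    ∃ P : GL (Fin 2) ℂ, (P : Matrix (Fin 2) (Fin 2) ℂ) *ᵥ u = Pi.single 0 1 := by
  by_cases h : u 0 = 0
  · have h1 : u 1 ≠ 0 := fun h1 => hu (by ext i; fin_cases i <;> simp [h, h1])
    refine ⟨Matrix.GeneralLinearGroup.mkOfDetNeZero !![0, (u 1)⁻¹; 1, 0] ?_, ?_⟩
    · simp [Matrix.det_fin_two, h1]
    · change !![0, (u 1)⁻¹; 1, 0] *ᵥ u = _
      ext i
      fin_cases i <;> simp [Matrix.mulVec, dotProduct, h, h1]
  · refine ⟨Matrix.GeneralLinearGroup.mkOfDetNeZero !![(u 0)⁻¹, 0; -u 1, u 0] ?_, ?_⟩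
    · simp [Matrix.det_fin_two, h]
    · change !![(u 0)⁻¹, 0; -u 1, u 0] *ᵥ u = _
      ext i
      fin_cases i <;> simp [Matrix.mulVec, dotProduct, h]
      ring

/-- A nonzero singular `2 × 2` matrix has rank one: its column and row through a nonzero entry `(k,
l)` give the factors. -/
theorem exists_eq_mul_of_polarDet_eq_zero {c : Fin 2 × Fin 2 → ℂ} (hc : c ≠ 0)
    (h : polarDet c c = 0) : ∃ u v : Fin 2 → ℂ, u ≠ 0 ∧ v ≠ 0 ∧ ∀ i j, c (i, j) = u i * v j := by
  obtain ⟨⟨k, l⟩, hkl⟩ := Function.ne_iff.mp hc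
  rw [Pi.zero_apply] at hkl
  have hd : c (0, 0) * c (1, 1) = c (0, 1) * c (1, 0) := by
    rw [polarDet] at h
    linear_combination h / 2
  refine ⟨fun i => c (i, l), fun j => c (k, j) / c (k, l), fun h => hkl (congrFun h k),
    fun h => ?_, fun i j => ?_⟩
  · have := congrFun h l
    simp [hkl] at this
  · rw [mul_div_assoc', eq_div_iff hkl]
    revert hkl
    fin_cases i <;> fin_cases j <;> fin_cases k <;> fin_cases l <;> intro _ <;>
      simp only [Fin.zero_eta, Fin.mk_one] <;> first | ring1 | linear_combination hd |
        linear_combination -hd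

theorem localSwap_mul_kronecker (P Q : Matrix (Fin 2) (Fin 2) ℂ) :
    localSwap * (P ⊗ₖ Q) = (Q ⊗ₖ P) * localSwap := by
  ext ⟨i, j⟩ ⟨k, l⟩
  simp only [Matrix.mul_apply, Fintype.sum_prod_type, Fin.sum_univ_two, localSwap,
    Matrix.of_apply, Prod.swap_prod_mk, Prod.mk.injEq, Matrix.kroneckerMap_apply]
  fin_cases i <;> fin_cases j <;> fin_cases k <;> fin_cases l <;> simp <;> ring

theorem localSwap_mul_apply (A : Matrix (Fin 2 × Fin 2) (Fin 2 × Fin 2) ℂ)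
    (p a : Fin 2 × Fin 2) : (localSwap * A : Matrix _ _ ℂ) p a = A p.swap a := by
  rw [Matrix.mul_apply, Finset.sum_eq_single p.swap]
  · simp [localSwap]
  · rintro q - hq
    rw [localSwap, Matrix.of_apply, if_neg, zero_mul]
    rintro rfl
    simp at hq
  · simp

/-- Three columns of an invertible matrix do not lie in a plane spanned by two basis vectors. -/
theorem false_of_columns_in_plane {A : Matrix (Fin 2 × Fin 2) (Fin 2 × Fin 2) ℂ}
    (hdet : A.det ≠ 0) (h0 : A.col (0, 0) = Pi.single (0, 0) 1) (p : Fin 2 × Fin 2)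
    (h1 : ∀ q, q ≠ p → q ≠ (0, 0) → A q (0, 1) = 0)
    (h2 : ∀ q, q ≠ p → q ≠ (0, 0) → A q (1, 0) = 0) : False := by
  -- Modulo the first basis vector, both columns are multiples of the basis vector `p`. The
  -- combination cancelling their `p`-entries lies in the kernel.
  have h3 := eq_zero_of_mulVec_eq_zero hdet
    (v := A p (0, 1) • (Pi.single (1, 0) 1 - A (0, 0) (1, 0) • Pi.single (0, 0) 1) -
      A p (1, 0) • (Pi.single (0, 1) 1 - A (0, 0) (0, 1) • Pi.single (0, 0) 1)) (by
      simp only [Matrix.mulVec_sub, Matrix.mulVec_smul, Matrix.mulVec_single_one, h0]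
      ext q
      by_cases hq : q = (0, 0)
      · subst hq; simp
      · by_cases hqp : q = p
        · subst hqp; simp [hq]; ring
        · simp [hq, h1 q hqp hq, h2 q hqp hq])
  have h4 : A p (0, 1) = 0 := by simpa using congrFun h3 (1, 0)
  have h5 := eq_zero_of_mulVec_eq_zero hdet
    (v := Pi.single (0, 1) 1 - A (0, 0) (0, 1) • Pi.single (0, 0) 1) (by
      simp only [Matrix.mulVec_sub, Matrix.mulVec_smul, Matrix.mulVec_single_one, h0]
      ext q
      by_cases hq : q = (0, 0)
      · subst hq; simp
      · by_cases hqp : q = p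
        · subst hqp; simp [hq, h4]
        · simp [hq, h1 q hqp hq])
  simpa using congrFun h5 (0, 1)

/-- Orthogonality to the first column kills the `(1, 1)` entries of columns `(0, 1)` and `(1, 0)`.
Being null, each of these columns then has at most one nonzero entry among `(0, 1)` and `(1, 0)`. By
invertibility the two columns use different entries; one assignment is the product case, the other
is its composition with the flip. -/
theorem PreservesDet.eq_kronecker_or_of_col {B : Matrix (Fin 2 × Fin 2) (Fin 2 × Fin 2) ℂ}
    (hB : PreservesDet B) (hdet : B.det ≠ 0) (hB0 : B.col (0, 0) = Pi.single (0, 0) 1) :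
    ∃ P Q : Matrix (Fin 2) (Fin 2) ℂ, B = P ⊗ₖ Q ∨ B = localSwap * (P ⊗ₖ Q) := by
  have e00 : B (0, 0) (0, 0) = 1 := by simpa using congrFun hB0 (0, 0)
  have e01 : B (0, 1) (0, 0) = 0 := by simpa using congrFun hB0 (0, 1)
  have e10 : B (1, 0) (0, 0) = 0 := by simpa using congrFun hB0 (1, 0)
  have e11 : B (1, 1) (0, 0) = 0 := by simpa using congrFun hB0 (1, 1)
  have f1 := hB.fst 0
  have f3 := hB.snd 0
  have f7 := hB.diag (0, 1)
  have f8 := hB.diag (1, 0)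
  simp only [polarDet, Matrix.col_apply, e00, e01, e10, e11] at f1 f3 f7 f8
  have g1 : B (1, 1) (0, 1) = 0 := by linear_combination f1
  have g2 : B (1, 1) (1, 0) = 0 := by linear_combination f3
  have g3 : B (0, 1) (0, 1) * B (1, 0) (0, 1) = 0 := by
    rw [g1] at f7
    linear_combination -f7 / 2
  have g4 : B (0, 1) (1, 0) * B (1, 0) (1, 0) = 0 := by
    rw [g2] at f8
    linear_combination -f8 / 2
  rcases mul_eq_zero.mp g3 with h3 | h3 <;> rcases mul_eq_zero.mp g4 with h4 | h4
  · refine (false_of_columns_in_plane hdet hB0 (1, 0) ?_ ?_).elim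
    · rintro ⟨i, j⟩
      fin_cases i <;> fin_cases j <;> simp [h3, g1]
    · rintro ⟨i, j⟩
      fin_cases i <;> fin_cases j <;> simp [h4, g2]
  · obtain ⟨P', Q', h⟩ := hB.localSwap_mul.eq_kronecker
      (by
        have : (localSwap * (localSwap * B)).det ≠ 0 := by
          rwa [← mul_assoc, localSwap_mul_self, one_mul]
        rw [Matrix.det_mul] at this
        exact right_ne_zero_of_mul this)
      (by
        ext ⟨i, j⟩
        rw [Matrix.col_apply, localSwap_mul_apply]
        fin_cases i <;> fin_cases j <;> simp [e00, e01, e10, e11])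
      (by rw [localSwap_mul_apply]; exact h3) (by rw [localSwap_mul_apply]; exact h4)
    refine ⟨P', Q', Or.inr ?_⟩
    rw [← h, ← mul_assoc, localSwap_mul_self, one_mul]
  · obtain ⟨P', Q', h⟩ := hB.eq_kronecker hdet hB0 h3 h4
    exact ⟨P', Q', Or.inl h⟩
  · refine (false_of_columns_in_plane hdet hB0 (0, 1) ?_ ?_).elim
    · rintro ⟨i, j⟩
      fin_cases i <;> fin_cases j <;> simp [h3, g1]
    · rintro ⟨i, j⟩
      fin_cases i <;> fin_cases j <;> simp [h4, g2]

/-- An invertible operator on `ℂ² ⊗ ℂ²` preserving the determinant up to a factor is a product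
of two local operators, up to the flip. -/
theorem PreservesDet.eq_kronecker_or {A : Matrix (Fin 2 × Fin 2) (Fin 2 × Fin 2) ℂ}
    (hA : PreservesDet A) (hdet : A.det ≠ 0) :
    ∃ P Q : Matrix (Fin 2) (Fin 2) ℂ, A = P ⊗ₖ Q ∨ A = localSwap * (P ⊗ₖ Q) := by
  have hc : A.col (0, 0) ≠ 0 := by
    intro h
    have := eq_zero_of_mulVec_eq_zero hdet (v := Pi.single (0, 0) 1)
      (by rw [Matrix.mulVec_single_one, h])
    simpa using congrFun this (0, 0)
  obtain ⟨u, v, hu, hv, huv⟩ := exists_eq_mul_of_polarDet_eq_zero hc (hA.diag (0, 0))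
  obtain ⟨P, hP⟩ := exists_mulVec_eq_single u hu
  obtain ⟨Q, hQ⟩ := exists_mulVec_eq_single v hv
  -- The first column is null, hence a product vector, and a local change of basis on the output
  -- side moves it to the first basis vector.
  set B := ((P : Matrix (Fin 2) (Fin 2) ℂ) ⊗ₖ (Q : Matrix (Fin 2) (Fin 2) ℂ)) * A with hBdef
  have hB : PreservesDet B := hA.kronecker_mul _ _
  have hPQ : (((P⁻¹ : GL (Fin 2) ℂ) : Matrix (Fin 2) (Fin 2) ℂ) ⊗ₖ
      ((Q⁻¹ : GL (Fin 2) ℂ) : Matrix (Fin 2) (Fin 2) ℂ)) * B = A := by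
    rw [hBdef, ← mul_assoc, ← Matrix.mul_kronecker_mul, ← Units.val_mul, ← Units.val_mul,
      inv_mul_cancel, inv_mul_cancel, Units.val_one, Matrix.one_kronecker_one, one_mul]
  have hBdet : B.det ≠ 0 := by
    intro h
    rw [← hPQ, Matrix.det_mul, h, mul_zero] at hdet
    exact hdet rfl
  have hB0 : B.col (0, 0) = Pi.single (0, 0) 1 := by
    rw [hBdef, col_mul]
    ext ⟨i, j⟩
    have hi := congrFun hP i
    have hj := congrFun hQ j
    simp only [Matrix.mulVec, dotProduct, Fin.sum_univ_two] at hi hj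
    simp only [Matrix.mulVec, dotProduct, Fintype.sum_prod_type, Fin.sum_univ_two,
      Matrix.kroneckerMap_apply, huv]
    have : (Pi.single (0, 0) 1 : Fin 2 × Fin 2 → ℂ) (i, j) =
        (Pi.single 0 1 : Fin 2 → ℂ) i * (Pi.single 0 1 : Fin 2 → ℂ) j := by
      fin_cases i <;> fin_cases j <;> simp
    rw [this, ← hi, ← hj]
    ring
  obtain ⟨P', Q', h | h⟩ := hB.eq_kronecker_or_of_col hBdet hB0
  · refine ⟨((P⁻¹ : GL (Fin 2) ℂ) : Matrix (Fin 2) (Fin 2) ℂ) * P',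
      ((Q⁻¹ : GL (Fin 2) ℂ) : Matrix (Fin 2) (Fin 2) ℂ) * Q', Or.inl ?_⟩
    rw [← hPQ, h, ← Matrix.mul_kronecker_mul]
  · refine ⟨((Q⁻¹ : GL (Fin 2) ℂ) : Matrix (Fin 2) (Fin 2) ℂ) * P',
      ((P⁻¹ : GL (Fin 2) ℂ) : Matrix (Fin 2) (Fin 2) ℂ) * Q', Or.inr ?_⟩
    rw [Matrix.mul_kronecker_mul, ← mul_assoc, localSwap_mul_kronecker, mul_assoc, ← h, hPQ]

end KroneckerClassification

end MultiState

/-! ### Proportionality of the local factors of a symmetry -/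

namespace MultiState

section ProportionalFactors

theorem IsBisymmetric.of_const_mul {d : Type} {t : d × d → d × d → ℂ} {c : ℂ} (hc : c ≠ 0)
    (h : IsBisymmetric fun p q => c * t p q) : IsBisymmetric t :=
  fun p q => ⟨mul_left_cancel₀ hc (h p q).1, mul_left_cancel₀ hc (h p q).2⟩

/-- Contraction with a singlet in each copy; a symmetric tensor has no singlet component. -/
theorem IsBisymmetric.contract_eq_zero {t : Fin 2 × Fin 2 → Fin 2 × Fin 2 → ℂ}
    (h : IsBisymmetric t) :
    t (0, 0) (1, 1) + t (1, 1) (0, 0) - t (0, 1) (1, 0) - t (1, 0) (0, 1) = 0 := by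
  have h1 := (h (0, 0) (1, 1)).1
  have h2 := (h (0, 0) (1, 1)).2
  have h3 := h.symm (0, 0) (1, 1)
  dsimp only at h1 h2
  rw [h1, h2, h3]
  ring

/-- The products of the columns of the operators of two parties which a symmetry of two copies
of a permutation invariant state makes bisymmetric. -/
structure BisymmetricColumns (A B : Matrix (Fin 2 × Fin 2) (Fin 2 × Fin 2) ℂ) : Prop where
  diag : ∀ a, IsBisymmetric fun p q => A p a * B q a
  fst : ∀ i, IsBisymmetric fun p q => A p (i, 0) * B q (i, 1) + A p (i, 1) * B q (i, 0)
  snd : ∀ i, IsBisymmetric fun p q => A p (0, i) * B q (1, i) + A p (1, i) * B q (0, i)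
  cross : IsBisymmetric fun p q => A p (0, 0) * B q (1, 1) + A p (1, 1) * B q (0, 0) +
    (A p (0, 1) * B q (1, 0) + A p (1, 0) * B q (0, 1))

theorem exists_smul_of_mul_symm {m : Type*} {c c' : m → ℂ} (hc : c ≠ 0)
    (h : ∀ p q, c q * c' p = c p * c' q) : ∃ r : ℂ, c' = r • c := by
  obtain ⟨p, hp⟩ := Function.ne_iff.mp hc
  rw [Pi.zero_apply] at hp
  refine ⟨c' p / c p, ?_⟩
  ext q
  rw [Pi.smul_apply, smul_eq_mul, div_mul_eq_mul_div, eq_div_iff hp]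
  linear_combination h q p

theorem col_not_proportional {m : Type*} [Fintype m] [DecidableEq m] {A : Matrix m m ℂ}
    (hA : A.det ≠ 0) {a b : m} (hab : a ≠ b) (h : ∀ p q, A p a * A q b = A q a * A p b) :
    False := by
  have hb : A.col b ≠ 0 := fun h0 => by
    have := eq_zero_of_mulVec_eq_zero hA (v := Pi.single b 1)
      (by rw [Matrix.mulVec_single_one, h0])
    simpa using congrFun this b
  obtain ⟨r, hr⟩ := exists_smul_of_mul_symm hb (c' := A.col a) fun p q => by
    simp only [Matrix.col_apply]
    linear_combination h p q
  have := eq_zero_of_mulVec_eq_zero hA (v := Pi.single a 1 - r • Pi.single b 1) (by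
    rw [Matrix.mulVec_sub, Matrix.mulVec_smul, Matrix.mulVec_single_one,
      Matrix.mulVec_single_one, hr, sub_self])
  simpa [hab] using congrFun this a

/-- Symmetry of the product of the columns `a` makes column `a` of `B` equal to `r a` times that of
`A`. Symmetry of a mixed sum for `a`, `b` gives `(r a - r b)` times a minor of the columns `a`, `b`
of `A`. Some such minor is nonzero because `A` is invertible, so `r a = r b`. -/
theorem BisymmetricColumns.exists_smul {A B : Matrix (Fin 2 × Fin 2) (Fin 2 × Fin 2) ℂ}
    (h : BisymmetricColumns A B) (hA : A.det ≠ 0) (hB : B.det ≠ 0) : ∃ r : ℂ, r ≠ 0 ∧ B = r • A := by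
  have hcol : ∀ a, ∃ r : ℂ, B.col a = r • A.col a := fun a => by
    have ha : A.col a ≠ 0 := fun h0 => by
      have := eq_zero_of_mulVec_eq_zero hA (v := Pi.single a 1)
        (by rw [Matrix.mulVec_single_one, h0])
      simpa using congrFun this a
    exact exists_smul_of_mul_symm ha fun p q => (h.diag a).symm p q
  choose r hr using hcol
  have hB' : ∀ p a, B p a = r a * A p a := fun p a => congrFun (hr a) p
  have heq : ∀ a b, a ≠ b →
      IsBisymmetric (fun p q => A p a * B q b + A p b * B q a) → r a = r b := by
    intro a b hab hs
    by_contra hne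
    refine col_not_proportional hA hab fun p q => ?_
    have := hs.symm p q
    simp only [hB'] at this
    refine mul_left_cancel₀ (sub_ne_zero.mpr hne) ?_
    linear_combination this
  have h1 : r (0, 0) = r (0, 1) := heq _ _ (by simp) (h.fst 0)
  have h2 : r (1, 0) = r (1, 1) := heq _ _ (by simp) (h.fst 1)
  have h3 : r (0, 0) = r (1, 0) := heq _ _ (by simp) (h.snd 0)
  have hall : ∀ a, r a = r (0, 0) := by
    rintro ⟨i, j⟩
    fin_cases i <;> fin_cases j <;> simp [← h1, ← h2, ← h3]
  have hBA : B = r (0, 0) • A := by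
    ext p a
    rw [hB', hall, Matrix.smul_apply, smul_eq_mul]
  refine ⟨r (0, 0), fun h0 => hB ?_, hBA⟩
  rw [hBA, h0, zero_smul, Matrix.det_zero]

/-- For `B = r A`, the double singlet contraction of the bisymmetric tensors is `r` times the
corresponding polarized determinant, up to a factor 2 in the mixed cases. -/
theorem BisymmetricColumns.preservesDet {A : Matrix (Fin 2 × Fin 2) (Fin 2 × Fin 2) ℂ} {r : ℂ}
    (hr : r ≠ 0) (h : BisymmetricColumns A (r • A)) : PreservesDet A where
  diag a := by
    have := (h.diag a).contract_eq_zero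
    simp only [Matrix.smul_apply, smul_eq_mul] at this
    refine mul_left_cancel₀ hr ?_
    simp only [polarDet, Matrix.col_apply]
    linear_combination this
  fst i := by
    have := (h.fst i).contract_eq_zero
    simp only [Matrix.smul_apply, smul_eq_mul] at this
    refine mul_left_cancel₀ hr ?_
    simp only [polarDet, Matrix.col_apply]
    linear_combination this / 2
  snd i := by
    have := (h.snd i).contract_eq_zero
    simp only [Matrix.smul_apply, smul_eq_mul] at this
    refine mul_left_cancel₀ hr ?_
    simp only [polarDet, Matrix.col_apply]
    linear_combination this / 2
  cross := by
    have := h.cross.contract_eq_zero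
    simp only [Matrix.smul_apply, smul_eq_mul] at this
    refine mul_left_cancel₀ hr ?_
    simp only [polarDet, Matrix.col_apply]
    linear_combination this / 2

end ProportionalFactors

/-! ### Two-party slices of the five-qubit state -/

section Slices

/-- The amplitudes of the five-qubit state as a function of the number of ones. -/
noncomputable def amp (m : ℕ) : ℂ :=
  ((√22 : ℝ) : ℂ)⁻¹ * (if m = 0 then ((√7 : ℝ) : ℂ) else if m = 5 then ((√5 : ℝ) : ℂ)
    else if m = 3 then 1 else 0)

theorem fiveQubit_apply (x : Fin 5 → Fin 2) : fiveQubit x = amp (∑ j, (x j : ℕ)) := rfl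

theorem amp_zero : amp 0 = ((√22 : ℝ) : ℂ)⁻¹ * ((√7 : ℝ) : ℂ) := by simp [amp]
theorem amp_one : amp 1 = 0 := by simp [amp]
theorem amp_two : amp 2 = 0 := by simp [amp]
theorem amp_three : amp 3 = ((√22 : ℝ) : ℂ)⁻¹ := by simp [amp]
theorem amp_four : amp 4 = 0 := by simp [amp]
theorem amp_five : amp 5 = ((√22 : ℝ) : ℂ)⁻¹ * ((√5 : ℝ) : ℂ) := by simp [amp]

theorem sqrt_twentyTwo_ne_zero : ((√22 : ℝ) : ℂ) ≠ 0 := by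
  rw [Complex.ofReal_ne_zero]
  positivity

theorem amp_zero_ne_zero : amp 0 ≠ 0 := by
  rw [amp_zero]
  refine mul_ne_zero (inv_ne_zero sqrt_twentyTwo_ne_zero) ?_
  rw [Complex.ofReal_ne_zero]
  positivity

theorem amp_three_ne_zero : amp 3 ≠ 0 := by
  rw [amp_three]
  exact inv_ne_zero sqrt_twentyTwo_ne_zero

theorem fiveQubit_perm (σ : Equiv.Perm (Fin 5)) (x : Fin 5 → Fin 2) :
    fiveQubit (fun k => x (σ k)) = fiveQubit x := by
  rw [fiveQubit_apply, fiveQubit_apply, Equiv.sum_comp σ fun k => (x k : ℕ)]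

/-- The three other parties can be put into a basis state with any number `m ≤ 2` of ones. The
slices for `m = 0, 1, 2` are multiples of `|00⟩`, `|11⟩` and `|01⟩ + |10⟩`. -/
theorem exists_slice {i j : Fin 5} (hij : i ≠ j) {m : ℕ} (hm : m ≤ 2) :
    ∃ w : Fin 5 → Fin 2, ∀ a b : Fin 2,
      fiveQubit (Function.update (Function.update w i a) j b) = amp ((a : ℕ) + b + m) := by
  have hc : ((Finset.univ.erase i).erase j).card = 3 := by
    rw [Finset.card_erase_of_mem (by simp [hij.symm]), Finset.card_erase_of_mem (by simp)]
    rfl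
  obtain ⟨T, hT, rfl⟩ := Finset.exists_subset_card_eq (s := (Finset.univ.erase i).erase j)
    (n := m) (by omega)
  refine ⟨fun k => if k ∈ T then 1 else 0, fun a b => ?_⟩
  rw [fiveQubit_apply]
  congr 1
  rw [← Finset.add_sum_erase _ _ (Finset.mem_univ i),
    ← Finset.add_sum_erase _ _ (show j ∈ Finset.univ.erase i by simp [hij.symm]), ← add_assoc]
  congr 1
  · simp [hij]
  · rw [Finset.card_eq_sum_ones, ← Finset.sum_subset hT]
    · refine Finset.sum_congr rfl fun k hk => ?_
      have := hT hk
      simp only [Finset.mem_erase, Finset.mem_univ, and_true] at this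
      simp [this.1, this.2, hk]
    · intro k hk hkT
      simp only [Finset.mem_erase, Finset.mem_univ, and_true] at hk
      simp [hk.1, hk.2, hkT]

theorem isBisymmetric_slice {S : Fin 5 → GL (Fin 2 × Fin 2) ℂ}
    (hS : prodOp (fun k => (S k : Matrix (Fin 2 × Fin 2) (Fin 2 × Fin 2) ℂ)) *ᵥ
      ketTensor fiveQubit fiveQubit = ketTensor fiveQubit fiveQubit)
    {i j : Fin 5} (hij : i ≠ j) {m n : ℕ} (hm : m ≤ 2) (hn : n ≤ 2) :
    IsBisymmetric fun p q => ∑ y, ∑ z, S i p y * (S j q z *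
      (amp ((y.1 : ℕ) + z.1 + m) * amp ((y.2 : ℕ) + z.2 + n))) := by
  obtain ⟨v, hv⟩ := exists_slice hij hm
  obtain ⟨w, hw⟩ := exists_slice hij hn
  have := isBisymmetric_of_stabilizer fiveQubit_perm hS hij fun k => (v k, w k)
  convert this using 10 with p q y _ z _
  rw [ketTensor, ← hv, ← hw]
  congr 2
  · ext1 k
    by_cases hk : k = j
    · subst hk; simp
    · by_cases hk' : k = i
      · subst hk'; simp [hij]
      · simp [hk, hk']
  · ext1 k
    by_cases hk : k = j
    · subst hk; simp
    · by_cases hk' : k = i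
      · subst hk'; simp [hij]
      · simp [hk, hk']

/-- Each condition is the image of a product of two slices, one per copy: weights 0 and 1 select a
single index of the copy, weight 2 a symmetrised pair. -/
theorem bisymmetricColumns {S : Fin 5 → GL (Fin 2 × Fin 2) ℂ}
    (hS : prodOp (fun k => (S k : Matrix (Fin 2 × Fin 2) (Fin 2 × Fin 2) ℂ)) *ᵥ
      ketTensor fiveQubit fiveQubit = ketTensor fiveQubit fiveQubit)
    {i j : Fin 5} (hij : i ≠ j) :
    BisymmetricColumns (S i : Matrix (Fin 2 × Fin 2) (Fin 2 × Fin 2) ℂ) (S j) := by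
  have key : ∀ {m n : ℕ}, m ≤ 2 → n ≤ 2 → ∀ {c : ℂ} (_ : c ≠ 0)
      {t : Fin 2 × Fin 2 → Fin 2 × Fin 2 → ℂ},
      (∀ p q, (∑ y, ∑ z, S i p y * (S j q z *
        (amp ((y.1 : ℕ) + z.1 + m) * amp ((y.2 : ℕ) + z.2 + n)))) = c * t p q) →
      IsBisymmetric t := by
    intro m n hm hn c hc t ht
    have := isBisymmetric_slice hS hij hm hn
    simp only [ht] at this
    exact this.of_const_mul hc
  have h0 := amp_zero_ne_zero
  have h3 := amp_three_ne_zero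
  refine ⟨?_, ?_, ?_, ?_⟩
  · rintro ⟨a, b⟩
    fin_cases a <;> fin_cases b
    · refine key (m := 0) (n := 0) (by simp) (by simp) (mul_ne_zero h0 h0) fun p q => ?_
      simp [Fintype.sum_prod_type, amp_one, amp_two]
      ring
    · refine key (m := 0) (n := 1) (by simp) (by simp) (mul_ne_zero h0 h3) fun p q => ?_
      simp [Fintype.sum_prod_type, amp_one, amp_two]
      ring
    · refine key (m := 1) (n := 0) (by simp) (by simp) (mul_ne_zero h3 h0) fun p q => ?_
      simp [Fintype.sum_prod_type, amp_one, amp_two]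
      ring
    · refine key (m := 1) (n := 1) (by simp) (by simp) (mul_ne_zero h3 h3) fun p q => ?_
      simp [Fintype.sum_prod_type, amp_one, amp_two]
      ring
  · intro a
    fin_cases a
    · refine key (m := 0) (n := 2) (by simp) (by simp) (mul_ne_zero h0 h3) fun p q => ?_
      simp [Fintype.sum_prod_type, amp_one, amp_two, amp_four]
      ring
    · refine key (m := 1) (n := 2) (by simp) (by simp) (mul_ne_zero h3 h3) fun p q => ?_
      simp [Fintype.sum_prod_type, amp_one, amp_two, amp_four]
      ring
  · intro a
    fin_cases a
    · refine key (m := 2) (n := 0) (by simp) (by simp) (mul_ne_zero h0 h3) fun p q => ?_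
      simp [Fintype.sum_prod_type, amp_one, amp_two, amp_four]
      ring
    · refine key (m := 2) (n := 1) (by simp) (by simp) (mul_ne_zero h3 h3) fun p q => ?_
      simp [Fintype.sum_prod_type, amp_one, amp_two, amp_four]
      ring
  · refine key (m := 2) (n := 2) (by simp) (by simp) (mul_ne_zero h3 h3) fun p q => ?_
    simp [Fintype.sum_prod_type, amp_two, amp_four]
    ring

end Slices

/-! ### Rigidity of the binary quintic -/

section BinaryQuintic

/-- The coefficients of the binary quintic `√7 x⁵ + 10 x²y³ + √5 y⁵` after the substitution of
`(x, y)` by `(a, b) x + (c, d) y` are not proportional to the original ones unless the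
substitution is a scalar. -/
theorem scalar_of_quintic_invariant {r w a b c d k : ℂ} (hr : r ^ 2 = 5) (hw : w ^ 2 = 7)
    (hk : k ≠ 0)
    (g0 : w * a ^ 5 + 10 * a ^ 2 * b ^ 3 + r * b ^ 5 = k * w)
    (g1 : w * a ^ 4 * c + 6 * a ^ 2 * b ^ 2 * d + 4 * a * b ^ 3 * c + r * b ^ 4 * d = 0)
    (g2 : w * a ^ 3 * c ^ 2 + 3 * a ^ 2 * b * d ^ 2 + 6 * a * b ^ 2 * c * d + b ^ 3 * c ^ 2 +
      r * b ^ 3 * d ^ 2 = 0)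
    (g3 : w * a ^ 2 * c ^ 3 + a ^ 2 * d ^ 3 + 6 * a * b * c * d ^ 2 + 3 * b ^ 2 * c ^ 2 * d +
      r * b ^ 2 * d ^ 3 = k)
    (g4 : w * a * c ^ 4 + 4 * a * c * d ^ 3 + 6 * b * c ^ 2 * d ^ 2 + r * b * d ^ 4 = 0)
    (g5 : w * c ^ 5 + 10 * c ^ 2 * d ^ 3 + r * d ^ 5 = k * r) :
    b = 0 ∧ c = 0 ∧ a = d := by
  have hr0 : r ≠ 0 := by rintro rfl; norm_num at hr
  have hw0 : w ≠ 0 := by rintro rfl; norm_num at hw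
  have cov : (a * d - b * c) ^ 4 * (b * (r * w * a + 3 * b)) = 0 := by
    have : (a * d - b * c) ^ 4 * (b * (r * w * a + 3 * b)) =
        (w * a ^ 5 + 10 * a ^ 2 * b ^ 3 + r * b ^ 5) *
          (w * a * c ^ 4 + 4 * a * c * d ^ 3 + 6 * b * c ^ 2 * d ^ 2 + r * b * d ^ 4) -
        4 * (w * a ^ 4 * c + 6 * a ^ 2 * b ^ 2 * d + 4 * a * b ^ 3 * c + r * b ^ 4 * d) *
          (w * a ^ 2 * c ^ 3 + a ^ 2 * d ^ 3 + 6 * a * b * c * d ^ 2 + 3 * b ^ 2 * c ^ 2 * d +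
            r * b ^ 2 * d ^ 3) +
        3 * (w * a ^ 3 * c ^ 2 + 3 * a ^ 2 * b * d ^ 2 + 6 * a * b ^ 2 * c * d + b ^ 3 * c ^ 2 +
          r * b ^ 3 * d ^ 2) ^ 2 := by ring
    rw [this, g4, g1, g2]
    ring
  have hdet : a * d - b * c ≠ 0 := by
    intro h
    rcases eq_or_ne a 0 with rfl | ha
    · have hbc : b * c = 0 := by linear_combination -h
      rcases mul_eq_zero.mp hbc with rfl | rfl
      · apply hk
        refine mul_right_cancel₀ hw0 ?_
        linear_combination -g0
      · apply hk
        have h1 : r * b ^ 4 * d = 0 := by linear_combination g1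
        have h2 : k * w * d = 0 := by linear_combination b * h1 - d * g0
        have h3 : d = 0 := by simpa [hk, hw0] using h2
        subst h3
        linear_combination -g3
    · have hd : d = b * c / a := by
        rw [eq_div_iff ha]
        linear_combination h
      have h1 : k * w * c = 0 := by
        rw [← g0]
        have : a * (w * a ^ 4 * c + 6 * a ^ 2 * b ^ 2 * d + 4 * a * b ^ 3 * c + r * b ^ 4 * d) =
            (w * a ^ 5 + 10 * a ^ 2 * b ^ 3 + r * b ^ 5) * c := by
          linear_combination (6 * a ^ 2 * b ^ 2 + r * b ^ 4) * h
        rw [← this, g1, mul_zero]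
      have h2 : c = 0 := by simpa [hk, hw0] using h1
      subst h2
      have h3 : d = 0 := by simpa using hd
      subst h3
      apply hk
      linear_combination -g3
  rcases mul_eq_zero.mp cov with h | h
  · exact absurd h (pow_ne_zero 4 hdet)
  rcases mul_eq_zero.mp h with rfl | h
  · have ha : a ≠ 0 := by
      rintro rfl
      simp at hdet
    have hc : c = 0 := by
      have h1 : w * a ^ 4 * c = 0 := by linear_combination g1
      simpa [hw0, ha] using h1
    subst hc
    have hd : d ≠ 0 := by
      rintro rfl
      simp at hdet
    refine ⟨rfl, rfl, ?_⟩
    have e0 : a ^ 5 = k := mul_left_cancel₀ hw0 (by linear_combination g0)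
    have e5 : d ^ 5 = k := mul_left_cancel₀ hr0 (by linear_combination g5)
    have e3 : a ^ 2 * d ^ 3 = k := by linear_combination g3
    have h3 : a ^ 3 = d ^ 3 := mul_left_cancel₀ (pow_ne_zero 2 ha) (by linear_combination e0 - e3)
    have h2 : a ^ 2 = d ^ 2 := mul_right_cancel₀ (pow_ne_zero 3 hd) (by linear_combination e3 - e5)
    refine mul_left_cancel₀ (pow_ne_zero 2 ha) ?_
    linear_combination h3 - d * h2
  · exfalso
    -- Parametrises the other zero of the covariant, `r w a + 3 b = 0`, by `a = -3s`, `b = r w s`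
    -- (using `r² w² = 35`). Then `g1` and `g2` become a linear and a quadratic form in `(c, d)`.
    obtain ⟨s, hs⟩ : ∃ s, s = -a / 3 := ⟨_, rfl⟩
    have ha : a = -3 * s := by rw [hs]; ring
    have hb : b = r * w * s := by rw [hs]; linear_combination h / 3
    have hs0 : s ≠ 0 := by
      rintro rfl
      rw [ha, hb] at hdet
      simp at hdet
    subst ha hb
    have hrw : r ^ 2 * w ^ 2 = 35 := by linear_combination w ^ 2 * hr + 5 * hw
    have e1 : w * (81 - 420 * r) * c + (1890 + 1225 * r) * d = 0 := by
      refine mul_left_cancel₀ (pow_ne_zero 4 hs0) ?_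
      linear_combination g1 -
        (54 * s ^ 4 * d - 12 * s ^ 4 * c * w * r + r * s ^ 4 * d * (r ^ 2 * w ^ 2 + 35)) * hrw
    have e2 : w * (35 * r - 27) * c ^ 2 - 630 * c * d + w * (27 * r + 175) * d ^ 2 = 0 := by
      refine mul_left_cancel₀ (pow_ne_zero 3 hs0) ?_
      linear_combination g2 - (-18 * s ^ 3 * c * d + r * w * s ^ 3 * c ^ 2 +
        w * s ^ 3 * d ^ 2 * r ^ 2) * hrw - 35 * w * s ^ 3 * d ^ 2 * hr
    have hM : 81 - 420 * r ≠ 0 := by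
      intro h
      have : (81 : ℂ) ^ 2 = 420 ^ 2 * 5 := by linear_combination (81 + 420 * r) * h + 420 ^ 2 * hr
      norm_num at this
    have hN : 11267550 - 90383846 * r ≠ 0 := by
      intro h
      have : (11267550 : ℂ) ^ 2 = 90383846 ^ 2 * 5 := by
        linear_combination (11267550 + 90383846 * r) * h + 90383846 ^ 2 * hr
      norm_num at this
    -- Elimination of `c` from `e2` by means of `e1`, reduced with `w² = 7` and `r² = 5`. The
    -- coefficient is nonzero because its vanishing would contradict `r² = 5`.
    have e3 : (11267550 - 90383846 * r) * d ^ 2 = 0 := by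
      linear_combination w * (81 - 420 * r) ^ 2 * e2 -
        ((35 * r - 27) * (w * (81 - 420 * r) * c - (1890 + 1225 * r) * d) -
          630 * (81 - 420 * r) * d) * e1 -
        (81 - 420 * r) ^ 2 * (27 * r + 175) * d ^ 2 * hw -
        (85861475 * r + 646065) * d ^ 2 * hr
    have hd : d = 0 := by simpa [hN] using e3
    subst hd
    have hc : c = 0 := by simpa [hM, hw0] using e1
    subst hc
    simp at hdet

end BinaryQuintic

end MultiState

/-! ### Stabilizer and norms for the five-qubit state -/

namespace MultiState

section FiveQubit

theorem sum_fin_succ_arrow {n : ℕ} {α M : Type*} [Fintype α] [AddCommMonoid M]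
    (f : (Fin (n + 1) → α) → M) : ∑ x, f x = ∑ a, ∑ y : Fin n → α, f (Matrix.vecCons a y) := by
  rw [← Fintype.sum_prod_type', ← (Fin.consEquiv fun _ : Fin (n + 1) => α).sum_comp]
  rfl

theorem sum_fin_five_arrow {M : Type*} [AddCommMonoid M] (f : (Fin 5 → Fin 2) → M) :
    ∑ x, f x = ∑ a, ∑ b, ∑ c, ∑ d, ∑ e, f ![a, b, c, d, e] := by
  simp only [sum_fin_succ_arrow, Fintype.sum_unique]
  rfl

theorem prodOp_fiveQubit_apply (P : Matrix (Fin 2) (Fin 2) ℂ) (x : Fin 5 → Fin 2) :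
    (prodOp (fun _ => P) *ᵥ fiveQubit) x = ∑ a : Fin 2, ∑ b : Fin 2, ∑ c : Fin 2, ∑ d : Fin 2,
      ∑ e : Fin 2, P (x 0) a * P (x 1) b * P (x 2) c * P (x 3) d * P (x 4) e *
        amp ((a : ℕ) + b + c + d + e) := by
  simp only [Matrix.mulVec, dotProduct]
  rw [sum_fin_five_arrow]
  simp only [prodOp_apply, fiveQubit_apply, Fin.prod_univ_five, Fin.sum_univ_five]
  rfl

/-- One amplitude for each number of ones gives the six coefficients of the transformed quintic; the
common factor `22^{-1/2}` cancels. -/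
theorem eq_smul_one_of_fiveQubit {P : Matrix (Fin 2) (Fin 2) ℂ} {k : ℂ} (hk : k ≠ 0)
    (h : prodOp (fun _ => P) *ᵥ fiveQubit = k • fiveQubit) : P = P 0 0 • 1 := by
  have h22 := inv_ne_zero sqrt_twentyTwo_ne_zero
  have hx : ∀ x : Fin 5 → Fin 2, _ := fun x => (prodOp_fiveQubit_apply P x).symm.trans (congrFun h x)
  simp only [Fin.sum_univ_two, Pi.smul_apply, smul_eq_mul, fiveQubit_apply, Fin.sum_univ_five] at hx
  have g0 := hx ![0, 0, 0, 0, 0]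
  have g1 := hx ![1, 0, 0, 0, 0]
  have g2 := hx ![1, 1, 0, 0, 0]
  have g3 := hx ![1, 1, 1, 0, 0]
  have g4 := hx ![1, 1, 1, 1, 0]
  have g5 := hx ![1, 1, 1, 1, 1]
  simp [amp_zero, amp_one, amp_two, amp_three, amp_four, amp_five] at g0 g1 g2 g3 g4 g5
  have hw : ((√7 : ℝ) : ℂ) ^ 2 = 7 := by
    rw [← Complex.ofReal_pow, Real.sq_sqrt (by norm_num)]; norm_num
  have hr : ((√5 : ℝ) : ℂ) ^ 2 = 5 := by
    rw [← Complex.ofReal_pow, Real.sq_sqrt (by norm_num)]; norm_num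
  obtain ⟨h1, h2, h3⟩ := scalar_of_quintic_invariant hr hw hk (a := P 0 0) (b := P 0 1)
    (c := P 1 0) (d := P 1 1)
    (mul_left_cancel₀ h22 (by linear_combination g0))
    (mul_left_cancel₀ h22 (by linear_combination g1))
    (mul_left_cancel₀ h22 (by linear_combination g2))
    (mul_left_cancel₀ h22 (by linear_combination g3))
    (mul_left_cancel₀ h22 (by linear_combination g4))
    (mul_left_cancel₀ h22 (by linear_combination g5))
  ext i j
  fin_cases i <;> fin_cases j <;> simp [h1, h2, h3]

theorem fiveQubit_zero_ne_zero : fiveQubit 0 ≠ 0 := by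
  rw [fiveQubit_apply]
  simpa using amp_zero_ne_zero

/-- A symmetry of two copies of the five-qubit state of the form `c (⨂ P) ⊗ (⨂ Q)` is trivial. -/
theorem prodOp_eq_one_of_kronecker {S : LocalOps (Fin 5) (Fin 2 × Fin 2)}
    (hS : prodOp S *ᵥ ketTensor fiveQubit fiveQubit = ketTensor fiveQubit fiveQubit)
    {P Q : Matrix (Fin 2) (Fin 2) ℂ} {r : Fin 5 → ℂ} (h : ∀ k, S k = r k • (P ⊗ₖ Q)) :
    prodOp S = 1 := by
  obtain rfl : S = fun k => r k • (P ⊗ₖ Q) := funext h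
  rw [prodOp_smul] at hS ⊢
  rw [Matrix.smul_mulVec, prodOp_kronecker_mulVec] at hS
  have hxy : ∀ x y : Fin 5 → Fin 2, (∏ k, r k) * ((prodOp (fun _ => P) *ᵥ fiveQubit) x *
      (prodOp (fun _ => Q) *ᵥ fiveQubit) y) = fiveQubit x * fiveQubit y := fun x y =>
    congrFun hS fun k => (x k, y k)
  have h0 := fiveQubit_zero_ne_zero
  have h00 := hxy 0 0
  set R := ∏ k, r k
  set p := (prodOp (fun _ => P) *ᵥ fiveQubit) 0
  set q := (prodOp (fun _ => Q) *ᵥ fiveQubit) 0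
  have hne : R * (p * q) ≠ 0 := by
    rw [h00]
    exact mul_ne_zero h0 h0
  have hR : R ≠ 0 := left_ne_zero_of_mul hne
  have hp : p ≠ 0 := left_ne_zero_of_mul (right_ne_zero_of_mul hne)
  have hq : q ≠ 0 := right_ne_zero_of_mul (right_ne_zero_of_mul hne)
  -- Freezing the second copy at the all-zero state, where the amplitude is nonzero, separates the
  -- two copies.
  have hP := eq_smul_one_of_fiveQubit (P := P) (k := fiveQubit 0 / (R * q))
    (div_ne_zero h0 (mul_ne_zero hR hq)) (by
      ext x
      rw [Pi.smul_apply, smul_eq_mul, div_mul_eq_mul_div, eq_div_iff (mul_ne_zero hR hq)]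
      linear_combination hxy x 0)
  have hQ := eq_smul_one_of_fiveQubit (P := Q) (k := fiveQubit 0 / (R * p))
    (div_ne_zero h0 (mul_ne_zero hR hp)) (by
      ext x
      rw [Pi.smul_apply, smul_eq_mul, div_mul_eq_mul_div, eq_div_iff (mul_ne_zero hR hp)]
      linear_combination hxy 0 x)
  have hPQ : prodOp (fun _ : Fin 5 => P ⊗ₖ Q) = ((P 0 0 * Q 0 0) ^ 5) • 1 := by
    rw [hP, hQ, Matrix.smul_kronecker, Matrix.kronecker_smul, Matrix.one_kronecker_one, smul_smul,
      prodOp_smul (fun _ => P 0 0 * Q 0 0), prodOp_one]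
    simp
  have hφ := prodOp_kronecker_mulVec (fun _ => P) (fun _ => Q) fiveQubit fiveQubit
  rw [← hφ, hPQ] at hS
  have h1 := congrFun hS 0
  rw [Matrix.smul_mulVec, Matrix.one_mulVec, smul_smul, Pi.smul_apply, smul_eq_mul] at h1
  have h2 : ketTensor fiveQubit fiveQubit 0 ≠ 0 := mul_ne_zero h0 h0
  rw [hPQ, smul_smul, mul_right_cancel₀ h2 (h1.trans (one_mul _).symm), one_smul]

theorem stabilizer_fiveQubit :
    stabilizer (ketTensor fiveQubit fiveQubit) = {1, globalSwap} := by
  apply Set.Subset.antisymm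
  · rintro M ⟨S, rfl, hS⟩
    have hprop : ∀ j : Fin 5, j ≠ 0 → ∃ r : ℂ, r ≠ 0 ∧
        (S j : Matrix (Fin 2 × Fin 2) (Fin 2 × Fin 2) ℂ) = r • (S 0 : Matrix _ _ ℂ) := fun j hj =>
      (bisymmetricColumns hS hj.symm).exists_smul (S 0).det_ne_zero (S j).det_ne_zero
    have hall : ∀ j : Fin 5, ∃ r : ℂ,
        (S j : Matrix (Fin 2 × Fin 2) (Fin 2 × Fin 2) ℂ) = r • (S 0 : Matrix _ _ ℂ) := by
      intro j
      by_cases hj : j = 0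
      · exact ⟨1, by rw [hj, one_smul]⟩
      · obtain ⟨r, -, hr⟩ := hprop j hj
        exact ⟨r, hr⟩
    choose r hr using hall
    have hdet : PreservesDet (S 0 : Matrix (Fin 2 × Fin 2) (Fin 2 × Fin 2) ℂ) := by
      obtain ⟨s, hs, h⟩ := hprop 1 (by simp)
      have := bisymmetricColumns hS (show (0 : Fin 5) ≠ 1 by simp)
      rw [h] at this
      exact this.preservesDet hs
    obtain ⟨P, Q, h | h⟩ := hdet.eq_kronecker_or (S 0).det_ne_zero
    · exact Or.inl (prodOp_eq_one_of_kronecker hS fun k => by rw [hr, h])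
    -- In the flipped case, composing with SWAP gives a symmetry of product form, hence 1. The
    -- original symmetry is then SWAP.
    · have hsw : prodOp (fun k => localSwap * (S k : Matrix (Fin 2 × Fin 2) (Fin 2 × Fin 2) ℂ)) =
          globalSwap * prodOp (fun k => (S k : Matrix (Fin 2 × Fin 2) (Fin 2 × Fin 2) ℂ)) := by
        rw [globalSwap, prodOp_mul]
      have h1 := prodOp_eq_one_of_kronecker (P := P) (Q := Q) (r := r)
        (S := fun k => localSwap * (S k : Matrix (Fin 2 × Fin 2) (Fin 2 × Fin 2) ℂ))
        (by rw [hsw, ← Matrix.mulVec_mulVec, hS, globalSwap_mulVec_ketTensor])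
        (fun k => by
          rw [hr, h, Matrix.mul_smul, ← mul_assoc, localSwap_mul_self, one_mul])
      refine Or.inr (Set.mem_singleton_iff.mpr ?_)
      rw [hsw] at h1
      rw [← one_mul (prodOp _), ← globalSwap_mul_self, mul_assoc, h1, mul_one]
  · rintro M (rfl | hM)
    · exact one_mem_stabilizer _
    · rw [Set.mem_singleton_iff.mp hM]
      exact globalSwap_mem_stabilizer _

theorem ketNorm_applyLast_sq {d : Type} [Fintype d] [DecidableEq d] {n : ℕ} {h : Matrix d d ℂ}
    {D : d → ℝ} (hD : hᴴ * h = Matrix.diagonal fun a => (D a : ℂ)) (ψ : Ket (Fin (n + 1)) d) :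
    ketNorm (applyLast h ψ) ^ 2 = ∑ x, D (x (Fin.last n)) * ‖ψ x‖ ^ 2 := by
  have h1 : (prodOp (onLast h))ᴴ * prodOp (onLast (n := n) h) =
      prodOp (Function.update (fun _ => 1) (Fin.last n) (hᴴ * h)) := by
    rw [conjTranspose_mul_self_prodOp]
    congr 1
    ext1 j
    by_cases hj : j = Fin.last n
    · subst hj; simp [onLast]
    · simp [onLast, hj]
  have h2 : ((ketNorm (applyLast h ψ) ^ 2 : ℝ) : ℂ) =
      ((∑ x, D (x (Fin.last n)) * ‖ψ x‖ ^ 2 : ℝ) : ℂ) := by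
    rw [← star_dotProduct_self, applyLast, Matrix.star_mulVec, ← Matrix.dotProduct_mulVec,
      Matrix.mulVec_mulVec, h1]
    push_cast
    refine Finset.sum_congr rfl fun x _ => ?_
    rw [prodOp_update_one_mulVec, hD, Finset.sum_eq_single (x (Fin.last n))]
    · rw [Matrix.diagonal_apply_eq, Function.update_eq_self, Pi.star_apply, Complex.star_def,
        ← Complex.conj_mul']
      ring
    · intro b _ hb
      rw [Matrix.diagonal_apply_ne _ hb.symm, zero_mul]
    · simp
  exact_mod_cast h2

theorem norm_amp_sq (m : ℕ) : ‖amp m‖ ^ 2 =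
    (if m = 0 then 7 else if m = 5 then 5 else if m = 3 then 1 else 0) / 22 := by
  rw [amp, norm_mul, mul_pow, norm_inv, Complex.norm_real, Real.norm_of_nonneg (by positivity),
    inv_pow, Real.sq_sqrt (by norm_num), inv_mul_eq_div]
  congr 1
  split_ifs
  · rw [Complex.norm_real, Real.norm_of_nonneg (by positivity), Real.sq_sqrt (by norm_num)]
  · rw [Complex.norm_real, Real.norm_of_nonneg (by positivity), Real.sq_sqrt (by norm_num)]
  · simp
  · simp

/-- The last qubit is balanced: in units of 1/22, the value 0 has weight `7 + 4` and the value 1 has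
weight `5 + 6`, counting the strings with three ones. -/
theorem sum_last_mul_fiveQubit (D : Fin 2 → ℝ) :
    ∑ x : Fin 5 → Fin 2, D (x (Fin.last 4)) * ‖fiveQubit x‖ ^ 2 = (D 0 + D 1) / 2 := by
  simp only [fiveQubit_apply, norm_amp_sq]
  rw [sum_fin_five_arrow]
  simp only [Fin.sum_univ_five, Fin.sum_univ_two, show Fin.last 4 = (4 : Fin 5) from rfl]
  simp
  ring

theorem ketNorm_fiveQubit : ketNorm fiveQubit = 1 := by
  have h : ketNorm fiveQubit ^ 2 = 1 := by
    have := sum_last_mul_fiveQubit fun _ => 1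
    simp only [one_mul] at this
    rw [ketNorm_sq, this]
    norm_num
  exact (pow_eq_one_iff_of_nonneg (ketNorm_nonneg _) two_ne_zero).mp h

theorem ketNorm_applyLast_fiveQubit_one {ε : ℝ} {h : Matrix (Fin 2) (Fin 2) ℂ}
    (hh : hᴴ * h = diagOne ε) : ketNorm (applyLast (n := 4) h fiveQubit) ^ 2 = (1 + ε) / 2 := by
  rw [ketNorm_applyLast_sq (D := ![1, ε]), sum_last_mul_fiveQubit]
  · simp
  · rw [hh]
    ext i j
    fin_cases i <;> fin_cases j <;> simp [diagOne]

theorem ketNorm_applyLast_fiveQubit_two {ε : ℝ} {h : Matrix (Fin 2) (Fin 2) ℂ}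
    (hh : hᴴ * h = diagTwo ε) : ketNorm (applyLast (n := 4) h fiveQubit) ^ 2 = (1 + ε) / 2 := by
  rw [ketNorm_applyLast_sq (D := ![ε, 1]), sum_last_mul_fiveQubit]
  · simp [add_comm]
  · rw [hh]
    ext i j
    fin_cases i <;> fin_cases j <;> simp [diagTwo]

end FiveQubit

end MultiState

theorem mainTheorem11 :
    (∀ (n : ℕ) (ψ : MultiState.Ket (Fin (n + 1)) (Fin 2)), MultiState.ketNorm ψ = 1 →
      MultiState.stabilizer (MultiState.ketTensor ψ ψ) = {1, MultiState.globalSwap} →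
      ∀ ε : ℝ, 0 < ε → ε < 1 → ∀ h₁ h₂ : Matrix (Fin 2) (Fin 2) ℂ,
      h₁ᴴ * h₁ = MultiState.diagOne ε → h₂ᴴ * h₂ = MultiState.diagTwo ε →
      ∀ ψ₁ ψ₂ : MultiState.Ket (Fin (n + 1)) (Fin 2),
      ψ₁ = MultiState.applyLast h₁ ψ → ψ₂ = MultiState.applyLast h₂ ψ →
      ∃ p₁ p₂ p : ℝ,
        MultiState.IsMaxProb ψ ψ₁ p₁ ∧ MultiState.IsMaxProb ψ ψ₂ p₂ ∧
        MultiState.IsMaxProb (MultiState.ketTensor ψ ψ) (MultiState.ketTensor ψ₁ ψ₂) p ∧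
        p₁ = MultiState.ketNorm ψ₁ ^ 2 ∧ p₂ = MultiState.ketNorm ψ₂ ^ 2 ∧
        p = 2 / (1 + ε ^ 2) * (p₁ * p₂) ∧ p₁ * p₂ < p ∧
        ∃ M₃ : Matrix (Fin 2 × Fin 2) (Fin 2 × Fin 2) ℂ, M₃.PosSemidef ∧
          M₃ * M₃ = 1 -
            ((MultiState.measOp ε h₁ h₂)ᴴ * MultiState.measOp ε h₁ h₂ +
              (MultiState.measOp ε h₂ h₁)ᴴ * MultiState.measOp ε h₂ h₁) ∧
          MultiState.IsProtocol
            (MultiState.protocolSuccess n ε h₁ h₂ + {MultiState.onLast M₃}) ∧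
          MultiState.krausMap (MultiState.protocolSuccess n ε h₁ h₂)
              (MultiState.density (MultiState.ketTensor ψ ψ)) =
            (p : ℂ) • MultiState.density (MultiState.ketTensor ψ₁ ψ₂)) ∧
    (MultiState.ketNorm MultiState.fiveQubit = 1 ∧
      MultiState.stabilizer (MultiState.ketTensor MultiState.fiveQubit MultiState.fiveQubit) =
        {1, MultiState.globalSwap} ∧
      ∀ ε : ℝ, 0 < ε → ε < 1 → ∀ h₁ h₂ : Matrix (Fin 2) (Fin 2) ℂ,
      h₁ᴴ * h₁ = MultiState.diagOne ε → h₂ᴴ * h₂ = MultiState.diagTwo ε →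
      ∀ ψ₁ ψ₂ : MultiState.Ket (Fin 5) (Fin 2),
      ψ₁ = MultiState.applyLast (n := 4) h₁ MultiState.fiveQubit →
      ψ₂ = MultiState.applyLast (n := 4) h₂ MultiState.fiveQubit →
        MultiState.ketNorm ψ₁ = √((1 + ε) / 2) ∧ MultiState.ketNorm ψ₂ = √((1 + ε) / 2) ∧
        MultiState.IsMaxProb MultiState.fiveQubit ψ₁ ((1 + ε) / 2) ∧
        MultiState.IsMaxProb MultiState.fiveQubit ψ₂ ((1 + ε) / 2) ∧
        MultiState.IsMaxProb
          (MultiState.ketTensor MultiState.fiveQubit MultiState.fiveQubit)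
          (MultiState.ketTensor ψ₁ ψ₂) (2 / (1 + ε ^ 2) * ((1 + ε) / 2) ^ 2) ∧
        (1 + ε) / 2 < 2 / (1 + ε ^ 2) * ((1 + ε) / 2) ^ 2) := by
  refine ⟨?_, MultiState.ketNorm_fiveQubit, MultiState.stabilizer_fiveQubit, ?_⟩
  · rintro n ψ hψ hstab ε hε hε1 h₁ h₂ hh₁ hh₂ ψ₁ ψ₂ rfl rfl
    have htriv : ∀ M ∈ MultiState.stabilizer ψ, M = 1 := fun M hM =>
      MultiState.eq_one_of_mem_stabilizer hstab.subset hM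
    have hψ0 : ψ ≠ 0 := MultiState.ketNorm_ne_zero.mp (by rw [hψ]; exact one_ne_zero)
    have hφ₁ := MultiState.applyLast_ne_zero
      (MultiState.det_ne_zero_of_conjTranspose_mul_self (MultiState.det_diagOne hε) hh₁) hψ0
    have hφ₂ := MultiState.applyLast_ne_zero
      (MultiState.det_ne_zero_of_conjTranspose_mul_self (MultiState.det_diagTwo hε) hh₂) hψ0
    refine ⟨_, _, _, MultiState.isMaxProb_applyLast_diagOne hψ htriv hε hε1 hh₁,
      MultiState.isMaxProb_applyLast_diagTwo hψ htriv hε hε1 hh₂,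
      MultiState.isMaxProb_two_copies hψ hstab hε hh₁ hh₂, rfl, rfl, rfl, ?_,
      MultiState.failOp ε, MultiState.failOp_posSemidef ε, MultiState.failOp_mul_self hh₁ hh₂,
      MultiState.isProtocol_protocolSuccess hh₁ hh₂,
      MultiState.krausMap_protocolSuccess hψ (MultiState.ketTensor_ne_zero hφ₁ hφ₂)⟩
    have h1 := MultiState.ketNorm_ne_zero.mpr hφ₁
    have h2 := MultiState.ketNorm_ne_zero.mpr hφ₂
    refine lt_mul_of_one_lt_left (by positivity) ?_
    rw [one_lt_div (by positivity)]
    nlinarith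
  · rintro ε hε hε1 h₁ h₂ hh₁ hh₂ ψ₁ ψ₂ rfl rfl
    have htriv : ∀ M ∈ MultiState.stabilizer MultiState.fiveQubit, M = 1 := fun M hM =>
      MultiState.eq_one_of_mem_stabilizer MultiState.stabilizer_fiveQubit.subset hM
    have e₁ := MultiState.ketNorm_applyLast_fiveQubit_one hh₁
    have e₂ := MultiState.ketNorm_applyLast_fiveQubit_two hh₂
    refine ⟨?_, ?_, ?_, ?_, ?_, ?_⟩
    · rw [← e₁, Real.sqrt_sq (MultiState.ketNorm_nonneg _)]
    · rw [← e₂, Real.sqrt_sq (MultiState.ketNorm_nonneg _)]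
    · rw [← e₁]
      exact MultiState.isMaxProb_applyLast_diagOne MultiState.ketNorm_fiveQubit htriv hε hε1 hh₁
    · rw [← e₂]
      exact MultiState.isMaxProb_applyLast_diagTwo MultiState.ketNorm_fiveQubit htriv hε hε1 hh₂
    · have := MultiState.isMaxProb_two_copies (n := 4) MultiState.ketNorm_fiveQubit
        MultiState.stabilizer_fiveQubit hε hh₁ hh₂
      rwa [e₁, e₂, ← sq] at this
    -- After clearing denominators and the positive factor `1 + ε`, the claim is `1 + ε² < 1 + ε`,
    -- i.e. `ε (1 - ε) > 0`.
    · rw [div_mul_eq_mul_div, lt_div_iff₀ (by positivity)]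
      nlinarith [mul_pos hε (sub_pos.mpr hε1)]
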